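/- Let $\Omega$ be a $\sigma$-compact topological space with a positive regular Borel measure $\mu$, let $n\in\mathbb{N}$, let $K_1,K_2:\Omega\to\mathbb{C}$ be locally integrable, and let $(A(u))_{u\in\Omega}$, $(B(v))_{v\in\Omega}$ be $\mu$-measurable families of real self-adjoint (symmetric) $n\times n$ matrices such that all the matrices $A(u),B(v)$ ($u,v\in\Omega$) commute with each other, $A(u)$ is nonsingular for $\mu$-almost every $u$, $B(v)$ is nonsingular for $\mu$-almost every $v$, and $|\det A(u)|^{-1/2}K_1(u)$, $|\det B(v)|^{-1/2}K_2(v)$ belong to $L^1(\Omega,\mu)$. Then the Hausdorff operators $$(\mathcal{H}_{K_1,A}f)(x)=\int_\Omega K_1(u)f(A(u)x)\,d\mu(u),\qquad (\mathcal{H}_{K_2,B}f)(x)=\int_\Omega K_2(v)f(B(v)x)\,d\mu(v)$$ are well-defined bounded operators in the complex space $L^2(\mathbb{R}^n)$ (the integrals converge absolutely for almost every $x$). There is an orthogonal $n\times n$ matrix $C$ such that all the matrices $C^{-1}A(u)C=\mathrm{diag}(a_1(u),\dots,a_n(u))$ and $C^{-1}B(v)C=\mathrm{diag}(b_1(v),\dots,b_n(v))$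 are diagonal. Fix any such $C$ and any enumeration $U_1,\dots,U_{2^n}$ of the open hyperoctants of $\mathbb{R}^n$; let $\varepsilon(i;j)\in\{-1,1\}^n$ be the unique sign vector which takes $U_i$ to $U_j$ by coordinatewise multiplication. Let $\Omega_{ij}=\{u\in\Omega:(\mathrm{sgn}\,a_1(u),\dots,\mathrm{sgn}\,a_n(u))=\varepsilon(i;j)\}$ and let $\Phi_1=(\varphi_{ij})_{i,j=1}^{2^n}$ be the matrix symbol of $\mathcal{H}_{K_1,A}$, $$\varphi_{ij}(s)=\int_{\Omega_{ij}}K_1(u)\prod_{k=1}^n|a_k(u)|^{-1/2-\imath s_k}\,d\mu(u)\qquad(s\in\mathbb{R}^n),$$ and let $\Phi_2$ be the matrix symbol of $\mathcal{H}_{K_2,B}$, defined in the same way from $K_2$ and $b_1,\dots,b_n$ with the same $C$ and the same enumeration. Then multiplication by the matrix function $\Phi_1\Phi_2$ is a bounded operator $M_{\Phi_1\Phi_2}$ in $L^2(\mathbb{R}^n;\mathbb{C}^{2^n})$, and the product $\mathcal{H}_{K_1,A}\mathcal{H}_{K_2,B}$ is unitarily equivalent to $M_{\Phi_1\Phi_2}$.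 -/

import Mathlib

open MeasureTheory
open scoped Matrix

namespace Hausdorff

noncomputable section

/-- The Euclidean space `ℝⁿ`. -/
abbrev Rn (n : ℕ) : Type := EuclideanSpace ℝ (Fin n)

/-- The Hilbert space `ℂ^(2^n)`. -/
abbrev Cpow (n : ℕ) : Type := EuclideanSpace ℂ (Fin (2 ^ n))

/-- The complex Hilbert space `L²(ℝⁿ)` with respect to Lebesgue measure. -/
abbrev L2 (n : ℕ) : Type := Lp ℂ 2 (volume : Measure (Rn n))

/-- The Hilbert space `L²(ℝⁿ; ℂ^(2^n))`. -/
abbrev L2vec (n : ℕ) : Type := Lp (Cpow n) 2 (volume : Measure (Rn n))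

/-- The product of an `n × n` matrix and a column vector. -/
def act {n : ℕ} (A : Matrix (Fin n) (Fin n) ℝ) (x : Rn n) : Rn n :=
  WithLp.toLp 2 (A *ᵥ WithLp.ofLp x)

/-- `H` is the Hausdorff operator with kernel `K` and matrices `A(u)` as a bounded operator on
`L²(ℝⁿ)`: for every square integrable function `f` (not only for one representative of each class)
the integral `∫ K(u) f(A(u)x) dμ(u)` exists for almost every `x`, and it equals `(H f)(x)` almost
everywhere. -/
def IsHausdorffOperator {Ω : Type*} [MeasurableSpace Ω] (μ : Measure Ω) {n : ℕ} (K : Ω → ℂ)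
    (A : Ω → Matrix (Fin n) (Fin n) ℝ) (H : L2 n →L[ℂ] L2 n) : Prop :=
  ∀ (f : Rn n → ℂ) (hf : MemLp f 2 volume),
    (∀ᵐ x : Rn n, Integrable (fun u => K u * f (act (A u) x)) μ) ∧
    ∀ᵐ x : Rn n, (H (hf.toLp f) : Rn n → ℂ) x = ∫ u, K u * f (act (A u) x) ∂μ

/-- `M` is the operator of multiplication by the matrix function `Ψ` in `L²(ℝⁿ; ℂ^(2^n))`. -/
def IsMultiplicationOperator {n : ℕ} (Ψ : Rn n → Matrix (Fin (2 ^ n)) (Fin (2 ^ n)) ℂ)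
    (M : L2vec n →L[ℂ] L2vec n) : Prop :=
  ∀ g : L2vec n, ∀ᵐ s : Rn n, (M g : Rn n → Cpow n) s = WithLp.toLp 2 (Ψ s *ᵥ WithLp.ofLp (g s))

/-- Unitary equivalence of bounded operators on Hilbert spaces. -/
def UnitarilyEquivalent {E F : Type*} [NormedAddCommGroup E] [InnerProductSpace ℂ E]
    [NormedAddCommGroup F] [InnerProductSpace ℂ F] (T : E →L[ℂ] E) (S : F →L[ℂ] F) : Prop :=
  ∃ V : E ≃ₗᵢ[ℂ] F, ∀ x, V (T x) = S (V x)

/-- The orthogonal matrix `C` diagonalizes all the matrices `A(u)`. -/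
def Diagonalizes {Ω : Type*} {n : ℕ} (C : Matrix (Fin n) (Fin n) ℝ)
    (A : Ω → Matrix (Fin n) (Fin n) ℝ) : Prop :=
  C ∈ Matrix.orthogonalGroup (Fin n) ℝ ∧ ∀ u, (C⁻¹ * A u * C).IsDiag

/-- The diagonal entries `a₁(u), …, aₙ(u)` of `C⁻¹ A(u) C`. -/
def diagEntry {Ω : Type*} {n : ℕ} (C : Matrix (Fin n) (Fin n) ℝ)
    (A : Ω → Matrix (Fin n) (Fin n) ℝ) (u : Ω) (k : Fin n) : ℝ :=
  (C⁻¹ * A u * C) k k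

/-- The open hyperoctant of `ℝⁿ` with sign vector `σ`. An enumeration of the hyperoctants is given
by an enumeration of the sign vectors. -/
def octant {n : ℕ} (σ : Fin n → ℤˣ) : Set (Rn n) :=
  {x | ∀ k, 0 < ((σ k : ℤ) : ℝ) * x k}

/-- Coordinatewise multiplication by a sign vector. -/
def signMul {n : ℕ} (ε : Fin n → ℤˣ) (x : Rn n) : Rn n :=
  WithLp.toLp 2 fun k => ((ε k : ℤ) : ℝ) * x k

/-- The sign vector `ε(i; j)`, see `signMul_image_octant_iff`. -/
def eps {n : ℕ} (e : Fin (2 ^ n) ≃ (Fin n → ℤˣ)) (i j : Fin (2 ^ n)) : Fin n → ℤˣ :=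
  e i * e j

/-- `ε(i; j)` is the only sign vector that takes the `i`-th hyperoctant to the `j`-th one. -/
theorem signMul_image_octant_iff {n : ℕ} (e : Fin (2 ^ n) ≃ (Fin n → ℤˣ)) (i j : Fin (2 ^ n))
    (ε : Fin n → ℤˣ) : signMul ε '' octant (e i) = octant (e j) ↔ ε = eps e i j := by
  constructor
  · intro h
    have hx : (WithLp.toLp 2 fun k => (((e i) k : ℤ) : ℝ) : Rn n) ∈ octant (e i) := by
      intro k
      rcases Int.units_eq_one_or (e i k) with h1 | h1 <;> simp [h1]
    have hy := h ▸ Set.mem_image_of_mem (signMul ε) hx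
    funext k
    have hk := hy k
    simp only [signMul] at hk
    rcases Int.units_eq_one_or (e i k) with h1 | h1 <;>
    rcases Int.units_eq_one_or (e j k) with h2 | h2 <;>
    rcases Int.units_eq_one_or (ε k) with h3 | h3 <;>
    simp [eps, h1, h2, h3] at hk ⊢ <;> linarith
  · rintro rfl
    have key : ∀ k, ∀ t : ℝ, (((e j k : ℤˣ) : ℤ) : ℝ) * ((((e i k * e j k : ℤˣ) : ℤ) : ℝ) * t)
        = (((e i k : ℤˣ) : ℤ) : ℝ) * t := by
      intro k t
      rcases Int.units_eq_one_or (e i k) with h1 | h1 <;>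
      rcases Int.units_eq_one_or (e j k) with h2 | h2 <;> simp [h1, h2]
    have key2 : ∀ k, ∀ t : ℝ, (((e i k : ℤˣ) : ℤ) : ℝ) * ((((e i k * e j k : ℤˣ) : ℤ) : ℝ) * t)
        = (((e j k : ℤˣ) : ℤ) : ℝ) * t := by
      intro k t
      rcases Int.units_eq_one_or (e i k) with h1 | h1 <;>
      rcases Int.units_eq_one_or (e j k) with h2 | h2 <;> simp [h1, h2]
    ext y
    constructor
    · rintro ⟨x, hx, rfl⟩ k
      have := hx k
      simp only [signMul, eps, Pi.mul_apply, key]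
      exact this
    · intro hy
      refine ⟨signMul (eps e i j) y, fun k => ?_, ?_⟩
      · have := hy k
        simp only [signMul, eps, Pi.mul_apply, key2]
        exact this
      · ext k
        rcases Int.units_eq_one_or (e i k) with h1 | h1 <;>
        rcases Int.units_eq_one_or (e j k) with h2 | h2 <;> simp [signMul, eps, h1, h2]

/-- The set `Ω_ij` of all `u` such that `(sgn a₁(u), …, sgn aₙ(u)) = ε(i; j)`. -/
def signSet {Ω : Type*} {n : ℕ} (a : Ω → Fin n → ℝ) (e : Fin (2 ^ n) ≃ (Fin n → ℤˣ))
    (i j : Fin (2 ^ n)) : Set Ω :=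
  {u | ∀ k, Real.sign (a u k) = ((eps e i j k : ℤ) : ℝ)}

/-- `|a|^(-1/2 - i s) = ∏ₖ exp((-1/2 - i sₖ) log |aₖ|)`. -/
def absPow {n : ℕ} (a : Fin n → ℝ) (s : Rn n) : ℂ :=
  ∏ k, Complex.exp ((-(1 / 2 : ℂ) - Complex.I * (s k : ℂ)) * (Real.log |a k| : ℂ))

/-- The matrix symbol `Φ(s) = (φ_ij(s))` of the Hausdorff operator with kernel `K` and matrices
`A(u)`, with respect to a diagonalizing matrix `C` and an enumeration `e` of the hyperoctants:
`φ_ij(s)` is the integral of `K(u) |a(u)|^(-1/2 - i s)` over `Ω_ij`. -/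
def symbol {Ω : Type*} [MeasurableSpace Ω] (μ : Measure Ω) {n : ℕ} (K : Ω → ℂ)
    (A : Ω → Matrix (Fin n) (Fin n) ℝ) (C : Matrix (Fin n) (Fin n) ℝ)
    (e : Fin (2 ^ n) ≃ (Fin n → ℤˣ)) (s : Rn n) : Matrix (Fin (2 ^ n)) (Fin (2 ^ n)) ℂ :=
  Matrix.of fun i j =>
    ∫ u in signSet (diagEntry C A) e i j, K u * absPow (diagEntry C A u) s ∂μ

end

end Hausdorff

namespace Hausdorff

noncomputable section

/-! In the common eigenbasis given by the columns of `C`, each `A u` is a diagonal matrix: its signs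
permute the hyperoctants and its absolute values dilate them. With coordinates `y k = σ k * exp (-2π
t k)` on the hyperoctant of sign `σ`, a dilation by `a` becomes the translation by `-log |a| /
(2π)`. Weighting by the square root of the Jacobian gives a unitary `T` from scalar L² to
vector-valued L², with one component per hyperoctant (`exists_octEquiv`). Under `T`, the map sending
`f` to `f ∘ act (A u)` becomes `|det A u|^(-1/2)` times a permutation of components and a
translation (`octMap_comp_act`).

The Fourier transform turns the translation into a character, and the character times `|det A
u|^(-1/2)` is exactly `absPow` (`absPow_eq`). Hence `V`, the Fourier transform after `T`, takes each
`f ∘ act (A u)` to a matrix multiplier. Integrating against `K` gives the matrix symbol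
(`fourier_octEquiv_hausdorff`). The integration over `u` is done weakly, on inner products, where
Fubini applies.

`V` depends on `C` and `e` but on neither kernel nor matrix family. One `V` therefore diagonalizes
both operators, and the product goes to the product of the symbols. -/

/-! ### Simultaneous orthogonal diagonalization. -/

open Module.End in
-- Commuting symmetric maps have mutually orthogonal joint eigenspaces that span the space, even for
-- an infinite family; orthonormal bases of these are collected into one.
theorem exists_orthonormalBasis_joint_eigenvectors {ι E : Type*} [NormedAddCommGroup E]
    [InnerProductSpace ℝ E] [FiniteDimensional ℝ E] {n : ℕ} (hn : Module.finrank ℝ E = n)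
    (T : ι → Module.End ℝ E) (hT : ∀ i, (T i).IsSymmetric) (hc : ∀ i j, Commute (T i) (T j)) :
    ∃ b : OrthonormalBasis (Fin n) ℝ E, ∀ k i, ∃ c : ℝ, T i (b k) = c • b k := by
  classical
  have hint : DirectSum.IsInternal (fun χ : ι → ℝ => ⨅ i, eigenspace (T i) (χ i)) := by
    rw [OrthogonalFamily.isInternal_iff]
    · rw [LinearMap.IsSymmetric.iSup_iInf_eq_top_of_commute hT (fun i j _ => hc i j),
        Submodule.top_orthogonal_eq_bot]
    · exact LinearMap.IsSymmetric.orthogonalFamily_iInf_eigenspaces hT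
  have hof := LinearMap.IsSymmetric.orthogonalFamily_iInf_eigenspaces hT
  let v := hint.collectedBasis
    (fun χ => (stdOrthonormalBasis ℝ (⨅ i, eigenspace (T i) (χ i) : Submodule ℝ E)).toBasis)
  have hv : Orthonormal ℝ v := hint.collectedBasis_orthonormal hof (by
    intro χ
    rw [OrthonormalBasis.coe_toBasis]
    exact OrthonormalBasis.orthonormal _)
  -- The index runs over all functions `χ : ι → ℝ`, but it indexes a basis of a finite-dimensional
  -- space, so it is finite: almost all joint eigenspaces are zero.
  let _ := Module.Finite.finite_basis v
  let _ := Fintype.ofFinite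
    (Σ χ : ι → ℝ, Fin (Module.finrank ℝ (⨅ i, eigenspace (T i) (χ i) : Submodule ℝ E)))
  have hcard : Fintype.card
      (Σ χ : ι → ℝ, Fin (Module.finrank ℝ (⨅ i, eigenspace (T i) (χ i) : Submodule ℝ E)))
      = n := by
    rw [← Module.finrank_eq_card_basis v, hn]
  refine ⟨(v.toOrthonormalBasis hv).reindex (Fintype.equivFinOfCardEq hcard), fun k i => ?_⟩
  set p := (Fintype.equivFinOfCardEq hcard).symm k with hp
  have hmem := hint.collectedBasis_mem
    (fun χ => (stdOrthonormalBasis ℝ (⨅ i, eigenspace (T i) (χ i) : Submodule ℝ E)).toBasis) p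
  refine ⟨p.1 i, ?_⟩
  have h2 := (Submodule.mem_iInf _).1 hmem i
  rw [mem_eigenspace_iff] at h2
  simpa [v] using h2

theorem exists_orthogonal_diagonalizing {ι : Type*} {n : ℕ} (T : ι → Matrix (Fin n) (Fin n) ℝ)
    (hT : ∀ i, (T i).IsHermitian) (hc : ∀ i j, Commute (T i) (T j)) : ∃ C, Diagonalizes C T := by
  obtain ⟨b, hb⟩ := exists_orthonormalBasis_joint_eigenvectors (E := Rn n) (n := n) (by simp)
    (fun i => (T i).toEuclideanLin) (fun i => Matrix.isSymmetric_toEuclideanLin_iff.2 (hT i))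
    (fun i j => by
      refine LinearMap.ext fun x => ?_
      simp [Matrix.toLpLin_apply, Matrix.mulVec_mulVec, (hc i j).eq])
  have hdot : ∀ k l, ∑ i, b k i * b l i = if k = l then 1 else 0 := by
    intro k l
    have := orthonormal_iff_ite.1 b.orthonormal l k
    simpa [PiLp.inner_apply, eq_comm] using this
  let C : Matrix (Fin n) (Fin n) ℝ := Matrix.of fun i k => b k i
  have hCC : Cᵀ * C = 1 := by
    ext k l
    simp [C, Matrix.mul_apply, hdot, Matrix.one_apply]
  have hC : C ∈ Matrix.orthogonalGroup (Fin n) ℝ :=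
    (Matrix.mem_orthogonalGroup_iff' _ _).2 hCC
  refine ⟨C, hC, fun i k l hkl => ?_⟩
  obtain ⟨c, hc⟩ := hb l i
  have h1 : ∀ j, (T i * C) j l = c * b l j := by
    intro j
    have := congrArg (fun x : Rn n => x j) hc
    simpa [Matrix.toLpLin_apply, Matrix.mulVec, dotProduct, Matrix.mul_apply, C] using this
  rw [Matrix.inv_eq_left_inv hCC, Matrix.mul_assoc, Matrix.mul_apply]
  simp_rw [h1]
  have : ∑ j, Cᵀ k j * (c * b l j) = c * ∑ j, b k j * b l j := by
    rw [Finset.mul_sum]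
    refine Finset.sum_congr rfl fun j _ => ?_
    simp [C]; ring
  rw [this, hdot, if_neg hkl, mul_zero]

/-! ### Diagonal entries, moduli and signs. -/

section Diagonal

variable {Ω : Type*} {n : ℕ} {C : Matrix (Fin n) (Fin n) ℝ} {A : Ω → Matrix (Fin n) (Fin n) ℝ}

theorem Diagonalizes.isUnit_det (h : Diagonalizes C A) : IsUnit C.det :=
  Matrix.isUnit_det_of_left_inverse ((Matrix.mem_orthogonalGroup_iff' _ _).1 h.1)

theorem Diagonalizes.mul_eq (h : Diagonalizes C A) (u : Ω) :
    A u * C = C * Matrix.diagonal (diagEntry C A u) := by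
  have h1 : Matrix.diagonal (diagEntry C A u) = C⁻¹ * A u * C := (h.2 u).diagonal_diag
  rw [h1, Matrix.mul_assoc, Matrix.mul_nonsing_inv_cancel_left _ _ h.isUnit_det]

theorem Diagonalizes.det_eq (h : Diagonalizes C A) (u : Ω) :
    (A u).det = ∏ k, diagEntry C A u k := by
  have h1 := congrArg Matrix.det (h.mul_eq u)
  rw [Matrix.det_mul, Matrix.det_mul, Matrix.det_diagonal, mul_comm] at h1
  exact mul_left_cancel₀ h.isUnit_det.ne_zero h1

theorem Diagonalizes.abs_det_eq (h : Diagonalizes C A) (u : Ω) :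
    |(A u).det| = ∏ k, |diagEntry C A u k| := by
  rw [h.det_eq, Finset.abs_prod]

theorem Diagonalizes.diagEntry_ne_zero (h : Diagonalizes C A) {u : Ω} (hu : (A u).det ≠ 0)
    (k : Fin n) : diagEntry C A u k ≠ 0 := by
  rw [h.det_eq] at hu
  exact Finset.prod_ne_zero_iff.1 hu k (Finset.mem_univ k)

end Diagonal

/-- The part of the exponent containing `s` is purely imaginary. For the diagonal entries of `A u`
the value is the weight `|det A u|^(-1/2)` of the integrability hypothesis. -/
theorem norm_absPow {n : ℕ} (a : Fin n → ℝ) (ha : ∀ k, a k ≠ 0) (s : Rn n) :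
    ‖absPow a s‖ = (∏ k, |a k|) ^ (-(1 / 2) : ℝ) := by
  rw [absPow, norm_prod, ← Real.finsetProd_rpow _ _ (fun k _ => abs_nonneg _)]
  refine Finset.prod_congr rfl fun k _ => ?_
  rw [Complex.norm_exp, Real.rpow_def_of_pos (abs_pos.2 (ha k))]
  congr 1
  simp [mul_comm]

/-- For fixed `u` and `i` exactly one `j` qualifies, so at each such `u` the integrand of the symbol
has one possibly nonzero entry per row. Signs are their own inverses, hence `σ = e i * e j` can be
solved for `e j`. -/
theorem mem_signSet_iff {Ω : Type*} {n : ℕ} {a : Ω → Fin n → ℝ}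
    {e : Fin (2 ^ n) ≃ (Fin n → ℤˣ)} {i j : Fin (2 ^ n)} {u : Ω} {σ : Fin n → ℤˣ}
    (hσ : ∀ k, Real.sign (a u k) = ((σ k : ℤ) : ℝ)) :
    u ∈ signSet a e i j ↔ j = e.symm (e i * σ) := by
  have h1 : u ∈ signSet a e i j ↔ σ = eps e i j := by
    simp only [signSet, Set.mem_ofPred_eq, hσ, funext_iff, Int.cast_inj, Units.val_inj]
  rw [h1, Equiv.eq_symm_apply, eps]
  constructor
  · rintro rfl
    funext k
    simp [← mul_assoc, Int.units_mul_self]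
  · intro h
    rw [h]
    funext k
    simp [← mul_assoc, Int.units_mul_self]

theorem exists_signVector {n : ℕ} (a : Fin n → ℝ) (ha : ∀ k, a k ≠ 0) :
    ∃ σ : Fin n → ℤˣ, ∀ k, Real.sign (a k) = ((σ k : ℤ) : ℝ) := by
  refine ⟨fun k => if 0 < a k then 1 else -1, fun k => ?_⟩
  rcases lt_or_gt_of_ne (ha k) with h | h
  · simp [Real.sign_of_neg h, h.not_gt]
  · simp [Real.sign_of_pos h, h]

/-! ### Change of variables under an invertible matrix. -/

section Act

variable {n : ℕ}

theorem act_eq_toEuclideanLin (A : Matrix (Fin n) (Fin n) ℝ) :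
    (act A : Rn n → Rn n) = A.toEuclideanLin := by
  funext x
  simp [act, Matrix.toLpLin_apply]

theorem act_act (A B : Matrix (Fin n) (Fin n) ℝ) (x : Rn n) : act A (act B x) = act (A * B) x := by
  simp [act, Matrix.mulVec_mulVec]

theorem measurable_act (A : Matrix (Fin n) (Fin n) ℝ) : Measurable (act A : Rn n → Rn n) := by
  rw [act_eq_toEuclideanLin]
  exact (LinearMap.continuous_of_finiteDimensional _).measurable

theorem map_act {A : Matrix (Fin n) (Fin n) ℝ} (hA : A.det ≠ 0) :
    Measure.map (act A : Rn n → Rn n) volume = ENNReal.ofReal |A.det|⁻¹ • volume := by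
  have hdet : LinearMap.det A.toEuclideanLin = A.det := by
    rw [Matrix.toEuclideanLin_eq_toLin_orthonormal, LinearMap.det_toLin]
  rw [act_eq_toEuclideanLin, Measure.map_linearMap_addHaar_eq_smul_addHaar _ (by rwa [hdet]), hdet,
    abs_inv]

theorem quasiMeasurePreserving_act {A : Matrix (Fin n) (Fin n) ℝ} (hA : A.det ≠ 0) :
    Measure.QuasiMeasurePreserving (act A : Rn n → Rn n) volume volume :=
  ⟨measurable_act A, by
    rw [map_act hA]
    exact Measure.smul_absolutelyContinuous⟩

theorem lintegral_comp_act {A : Matrix (Fin n) (Fin n) ℝ} (hA : A.det ≠ 0) {F : Rn n → ENNReal}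
    (hF : AEMeasurable F) :
    ∫⁻ x, F (act A x) = ENNReal.ofReal |A.det|⁻¹ * ∫⁻ x, F x := by
  have hF' : AEMeasurable F (Measure.map (act A : Rn n → Rn n) volume) := by
    rw [map_act hA]
    exact hF.mono_ac Measure.smul_absolutelyContinuous
  rw [← lintegral_map' hF' (measurable_act A).aemeasurable, map_act hA, lintegral_smul_measure,
    smul_eq_mul]

theorem memLp_comp_act {A : Matrix (Fin n) (Fin n) ℝ} (hA : A.det ≠ 0) {f : Rn n → ℂ}
    (hf : MemLp f 2) : MemLp (fun x => f (act A x)) 2 := by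
  refine ⟨hf.1.comp_quasiMeasurePreserving (quasiMeasurePreserving_act hA), ?_⟩
  have h := hf.2
  rw [eLpNorm_lt_top_iff_lintegral_rpow_enorm_lt_top (by norm_num) (by norm_num)] at h ⊢
  rw [lintegral_comp_act (F := fun x => ‖f x‖ₑ ^ ENNReal.toReal 2) hA (hf.1.enorm.pow_const _)]
  exact ENNReal.mul_lt_top ENNReal.ofReal_lt_top h

end Act

/-- Cauchy–Schwarz for the splitting `k * g = k^(1/2) * (k^(1/2) * g)`. -/
theorem sq_lintegral_mul_le {α : Type*} [MeasurableSpace α] {μ : Measure α} {k g : α → ENNReal}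
    (hk : AEMeasurable k μ) (hg : AEMeasurable g μ) :
    (∫⁻ u, k u * g u ∂μ) ^ 2 ≤ (∫⁻ u, k u ∂μ) * ∫⁻ u, k u * g u ^ 2 ∂μ := by
  have hs : ∀ t : ENNReal, (t ^ (1 / 2 : ℝ)) ^ 2 = t := fun t => by
    rw [← ENNReal.rpow_natCast, ← ENNReal.rpow_mul]; norm_num
  have h := ENNReal.lintegral_mul_le_Lp_mul_Lq μ Real.HolderConjugate.two_two
    (f := fun u => k u ^ (1 / 2 : ℝ)) (g := fun u => k u ^ (1 / 2 : ℝ) * g u)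
    (hk.pow_const _) ((hk.pow_const _).mul hg)
  simp only [Pi.mul_apply, ENNReal.rpow_two, ← mul_assoc, ← sq, mul_pow, hs] at h
  calc _ ≤ _ := pow_le_pow_left' h 2
    _ = _ := by rw [mul_pow, hs, hs]

/-! ### Joint measurability and the L² bound. -/

section Operator

variable {Ω : Type*} [MeasurableSpace Ω] {μ : Measure Ω} {n : ℕ} {K : Ω → ℂ}
  {A : Ω → Matrix (Fin n) (Fin n) ℝ}

theorem exists_measurable_modification (hA : ∀ k l, AEMeasurable (fun u => A u k l) μ) :
    ∃ A' : Ω → Matrix (Fin n) (Fin n) ℝ, (∀ k l, Measurable fun u => A' u k l) ∧ A =ᵐ[μ] A' := by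
  refine ⟨fun u => Matrix.of fun k l => (hA k l).mk _ u, fun k l => (hA k l).measurable_mk, ?_⟩
  have : ∀ᵐ u ∂μ, ∀ k l, A u k l = (hA k l).mk _ u :=
    ae_all_iff.2 fun k => ae_all_iff.2 fun l => (hA k l).ae_eq_mk
  filter_upwards [this] with u hu
  ext k l
  exact hu k l

/-- `K` is recovered from the weighted kernel by multiplying with `|det A u|^(1/2)`. -/
theorem aestronglyMeasurable_of_det_smul (hA : ∀ k l, AEMeasurable (fun u => A u k l) μ)
    (hdet : ∀ᵐ u ∂μ, (A u).det ≠ 0)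
    (hK : Integrable (fun u => ((|(A u).det| ^ (-(1 / 2) : ℝ) : ℝ) : ℂ) * K u) μ) :
    AEStronglyMeasurable K μ := by
  have hd : AEMeasurable (fun u => (A u).det) μ := by
    simp only [Matrix.det_apply]
    fun_prop
  have h1 : AEMeasurable (fun u => ((|(A u).det| ^ (1 / 2 : ℝ) : ℝ) : ℂ)) μ := by fun_prop
  refine (h1.aestronglyMeasurable.mul hK.1).congr ?_
  filter_upwards [hdet] with u hu
  rw [Pi.mul_apply, ← mul_assoc, ← Complex.ofReal_mul, ← Real.rpow_add (abs_pos.2 hu)]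
  simp

theorem measurable_act_prod (hA : ∀ k l, Measurable fun u => A u k l) :
    Measurable fun p : Rn n × Ω => act (A p.2) p.1 := by
  refine (PiLp.continuous_toLp 2 _).measurable.comp (measurable_pi_lambda _ fun k => ?_)
  simp only [Matrix.mulVec, dotProduct]
  refine Finset.measurable_sum _ fun l _ => ((hA k l).comp measurable_snd).mul ?_
  have : Measurable fun x : Rn n => x l := by fun_prop
  exact this.comp measurable_fst

variable [SFinite μ]

/-- For almost every `u` the section of the preimage of a null set is its preimage under an
invertible matrix, hence null. This makes the Hausdorff integral independent of the representative
of `f`. -/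
theorem quasiMeasurePreserving_act_prod (hA : ∀ k l, Measurable fun u => A u k l)
    (hdet : ∀ᵐ u ∂μ, (A u).det ≠ 0) :
    Measure.QuasiMeasurePreserving (fun p : Rn n × Ω => act (A p.2) p.1)
      ((volume : Measure (Rn n)).prod μ) volume := by
  refine ⟨measurable_act_prod hA, Measure.AbsolutelyContinuous.mk fun s hs h0 => ?_⟩
  rw [Measure.map_apply (measurable_act_prod hA) hs,
    Measure.prod_apply_symm (measurable_act_prod hA hs), lintegral_eq_zero_iff'
      (measurable_measure_prodMk_right (measurable_act_prod hA hs)).aemeasurable]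
  filter_upwards [hdet] with u hu
  exact (quasiMeasurePreserving_act hu).preimage_null h0

theorem aestronglyMeasurable_comp_act_prod (hA : ∀ k l, AEMeasurable (fun u => A u k l) μ)
    (hdet : ∀ᵐ u ∂μ, (A u).det ≠ 0) {f : Rn n → ℂ} (hf : AEStronglyMeasurable f) :
    AEStronglyMeasurable (fun p : Rn n × Ω => f (act (A p.2) p.1))
      ((volume : Measure (Rn n)).prod μ) := by
  obtain ⟨A', hA', hAA'⟩ := exists_measurable_modification hA
  have hdet' : ∀ᵐ u ∂μ, (A' u).det ≠ 0 := by
    filter_upwards [hdet, hAA'] with u h1 h2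
    rwa [← h2]
  refine (hf.comp_quasiMeasurePreserving (quasiMeasurePreserving_act_prod hA' hdet')).congr ?_
  filter_upwards [Measure.quasiMeasurePreserving_snd.ae hAA'] with p hp
  simp [hp]

theorem ae_ae_act (hA : ∀ k l, AEMeasurable (fun u => A u k l) μ)
    (hdet : ∀ᵐ u ∂μ, (A u).det ≠ 0) {p : Rn n → Prop} (hp : ∀ᵐ y, p y) :
    ∀ᵐ x : Rn n, ∀ᵐ u ∂μ, p (act (A u) x) := by
  obtain ⟨A', hA', hAA'⟩ := exists_measurable_modification hA
  have hdet' : ∀ᵐ u ∂μ, (A' u).det ≠ 0 := by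
    filter_upwards [hdet, hAA'] with u h1 h2
    rwa [← h2]
  have := Measure.ae_ae_of_ae_prod ((quasiMeasurePreserving_act_prod hA' hdet').ae hp)
  filter_upwards [this] with x hx
  filter_upwards [hx, hAA'] with u h1 h2
  rwa [h2]

/-- The Hausdorff operator with absolute values inside is bounded in `L²`. -/
theorem lintegral_sq_lintegral_le (hA : ∀ k l, AEMeasurable (fun u => A u k l) μ)
    (hdet : ∀ᵐ u ∂μ, (A u).det ≠ 0)
    (hK : Integrable (fun u => ((|(A u).det| ^ (-(1 / 2) : ℝ) : ℝ) : ℂ) * K u) μ)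
    {f : Rn n → ℂ} (hf : AEStronglyMeasurable f) :
    ∫⁻ x, (∫⁻ u, ‖K u * f (act (A u) x)‖ₑ ∂μ) ^ 2 ≤
      (∫⁻ u, ‖((|(A u).det| ^ (-(1 / 2) : ℝ) : ℝ) : ℂ) * K u‖ₑ ∂μ) ^ 2 * ∫⁻ x, ‖f x‖ₑ ^ 2 := by
  set k : Ω → ENNReal := fun u => ‖((|(A u).det| ^ (-(1 / 2) : ℝ) : ℝ) : ℂ) * K u‖ₑ with hk
  -- Almost everywhere `|K| = k * d`. Cauchy–Schwarz is applied with the integrable weight `k`; the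
  -- remaining `d ^ 2 = |det A u|` cancels the Jacobian of `x ↦ A u x`.
  set d : Ω → ENNReal := fun u => ENNReal.ofReal (|(A u).det| ^ (1 / 2 : ℝ)) with hd
  have hdet_meas : AEMeasurable (fun u => (A u).det) μ := by
    simp only [Matrix.det_apply]
    fun_prop
  have hkm : AEMeasurable k μ := hK.1.enorm
  have hdm : AEMeasurable d μ := by fun_prop
  have hprod := aestronglyMeasurable_comp_act_prod (μ := μ) hA hdet hf
  have hkd : ∀ᵐ u ∂μ, ∀ z : ℂ, ‖K u * z‖ₑ = k u * (d u * ‖z‖ₑ) := by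
    filter_upwards [hdet] with u hu z
    have : ‖K u‖ₑ = k u * d u := by
      simp only [hk, hd]
      have h : ENNReal.ofReal (|(A u).det| ^ (1 / 2 : ℝ)) =
          ‖((|(A u).det| ^ (1 / 2 : ℝ) : ℝ) : ℂ)‖ₑ := by
        rw [← ofReal_norm, Complex.norm_of_nonneg (by positivity)]
      rw [h, ← enorm_mul, mul_right_comm, ← Complex.ofReal_mul, ← Real.rpow_add (abs_pos.2 hu)]
      simp
    rw [enorm_mul, this, mul_assoc]
  have h1 : ∀ᵐ x : Rn n, (∫⁻ u, ‖K u * f (act (A u) x)‖ₑ ∂μ) ^ 2 ≤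
      (∫⁻ u, k u ∂μ) * ∫⁻ u, k u * (d u * ‖f (act (A u) x)‖ₑ) ^ 2 ∂μ := by
    filter_upwards [hprod.prodMk_left] with x hx
    rw [lintegral_congr_ae (hkd.mono fun u hu => hu _)]
    exact sq_lintegral_mul_le hkm (hdm.mul hx.enorm)
  refine (lintegral_mono_ae h1).trans ?_
  have hm : AEMeasurable (Function.uncurry fun (x : Rn n) u =>
      k u * (d u * ‖f (act (A u) x)‖ₑ) ^ 2) ((volume : Measure (Rn n)).prod μ) :=
    (hkm.comp_quasiMeasurePreserving Measure.quasiMeasurePreserving_snd).mul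
      (((hdm.comp_quasiMeasurePreserving Measure.quasiMeasurePreserving_snd).mul
        hprod.enorm).pow_const 2)
  rw [lintegral_const_mul' _ _ hK.2.ne, lintegral_lintegral_swap hm, sq, mul_assoc]
  gcongr
  rw [← lintegral_mul_const'' _ hkm]
  refine (lintegral_congr_ae ?_).le
  filter_upwards [hdet] with u hu
  have h2 : ∀ x : Rn n, k u * (d u * ‖f (act (A u) x)‖ₑ) ^ 2 =
      k u * d u ^ 2 * ‖f (act (A u) x)‖ₑ ^ 2 := fun x => by ring
  simp_rw [h2]
  rw [lintegral_const_mul' _ _ (by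
      refine ENNReal.mul_ne_top enorm_ne_top (by simp [hd])),
    lintegral_comp_act (F := fun x => ‖f x‖ₑ ^ 2) hu (hf.enorm.pow_const 2), ← mul_assoc]
  congr 1
  rw [mul_assoc]
  simp only [hd]
  rw [← ENNReal.ofReal_pow (by positivity), ← Real.rpow_natCast, ← Real.rpow_mul (abs_nonneg _)]
  norm_num
  rw [← ENNReal.ofReal_mul (abs_nonneg _), mul_inv_cancel₀ (abs_ne_zero.2 hu)]
  simp

end Operator

/-! ### Hausdorff operators on L² and their weak form. -/

section Existence

variable {Ω : Type*} [MeasurableSpace Ω] {μ : Measure Ω} [SFinite μ] {n : ℕ} {K : Ω → ℂ}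
  {A : Ω → Matrix (Fin n) (Fin n) ℝ}

theorem lintegral_sq_lt_top_of_memLp {α E : Type*} [MeasurableSpace α] [NormedAddCommGroup E]
    {ν : Measure α} {f : α → E} (hf : MemLp f 2 ν) : ∫⁻ x, ‖f x‖ₑ ^ 2 ∂ν < ⊤ := by
  simpa using (eLpNorm_lt_top_iff_lintegral_rpow_enorm_lt_top (by norm_num) (by norm_num)).1 hf.2

theorem eLpNorm_two_eq {α E : Type*} [MeasurableSpace α] [NormedAddCommGroup E]
    {ν : Measure α} (f : α → E) : eLpNorm f 2 ν = (∫⁻ x, ‖f x‖ₑ ^ 2 ∂ν) ^ (1 / 2 : ℝ) := by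
  simp [eLpNorm_eq_lintegral_rpow_enorm_toReal (p := 2) (by norm_num) (by norm_num)]

theorem aestronglyMeasurable_kernel_mul (hA : ∀ k l, AEMeasurable (fun u => A u k l) μ)
    (hdet : ∀ᵐ u ∂μ, (A u).det ≠ 0)
    (hK : Integrable (fun u => ((|(A u).det| ^ (-(1 / 2) : ℝ) : ℝ) : ℂ) * K u) μ)
    {f : Rn n → ℂ} (hf : AEStronglyMeasurable f) :
    AEStronglyMeasurable (fun p : Rn n × Ω => K p.2 * f (act (A p.2) p.1))
      ((volume : Measure (Rn n)).prod μ) :=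
  ((aestronglyMeasurable_of_det_smul hA hdet hK).comp_quasiMeasurePreserving
    Measure.quasiMeasurePreserving_snd).mul (aestronglyMeasurable_comp_act_prod hA hdet hf)

theorem ae_integrable_hausdorff (hA : ∀ k l, AEMeasurable (fun u => A u k l) μ)
    (hdet : ∀ᵐ u ∂μ, (A u).det ≠ 0)
    (hK : Integrable (fun u => ((|(A u).det| ^ (-(1 / 2) : ℝ) : ℝ) : ℂ) * K u) μ)
    {f : Rn n → ℂ} (hf : MemLp f 2) :
    ∀ᵐ x : Rn n, Integrable (fun u => K u * f (act (A u) x)) μ := by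
  have hm := aestronglyMeasurable_kernel_mul hA hdet hK hf.1
  have h1 : ∫⁻ x, (∫⁻ u, ‖K u * f (act (A u) x)‖ₑ ∂μ) ^ 2 < ⊤ :=
    (lintegral_sq_lintegral_le hA hdet hK hf.1).trans_lt
      (ENNReal.mul_lt_top (ENNReal.pow_lt_top hK.2) (lintegral_sq_lt_top_of_memLp hf))
  have h2 := ae_lt_top' (hm.enorm.lintegral_prod_right'.pow_const 2) h1.ne
  filter_upwards [hm.prodMk_left, h2] with x hx1 hx2
  exact ⟨hx1, (ENNReal.pow_lt_top_iff.1 hx2).resolve_right (by norm_num)⟩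

theorem eLpNorm_hausdorff_le (hA : ∀ k l, AEMeasurable (fun u => A u k l) μ)
    (hdet : ∀ᵐ u ∂μ, (A u).det ≠ 0)
    (hK : Integrable (fun u => ((|(A u).det| ^ (-(1 / 2) : ℝ) : ℝ) : ℂ) * K u) μ)
    {f : Rn n → ℂ} (hf : AEStronglyMeasurable f) :
    eLpNorm (fun x : Rn n => ∫ u, K u * f (act (A u) x) ∂μ) 2 volume ≤
      (∫⁻ u, ‖((|(A u).det| ^ (-(1 / 2) : ℝ) : ℝ) : ℂ) * K u‖ₑ ∂μ) * eLpNorm f 2 volume := by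
  have hs : ∀ t : ENNReal, (t ^ 2) ^ (1 / 2 : ℝ) = t := fun t => by
    rw [← ENNReal.rpow_natCast, ← ENNReal.rpow_mul]; norm_num
  rw [eLpNorm_two_eq, eLpNorm_two_eq]
  rw [← hs (∫⁻ u, ‖((|(A u).det| ^ (-(1 / 2) : ℝ) : ℝ) : ℂ) * K u‖ₑ ∂μ)]
  rw [← ENNReal.mul_rpow_of_nonneg _ _ (by norm_num)]
  refine ENNReal.rpow_le_rpow (le_trans (lintegral_mono fun x => ?_)
    (lintegral_sq_lintegral_le hA hdet hK hf)) (by norm_num)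
  gcongr
  exact enorm_integral_le_lintegral_enorm _

theorem memLp_hausdorff (hA : ∀ k l, AEMeasurable (fun u => A u k l) μ)
    (hdet : ∀ᵐ u ∂μ, (A u).det ≠ 0)
    (hK : Integrable (fun u => ((|(A u).det| ^ (-(1 / 2) : ℝ) : ℝ) : ℂ) * K u) μ)
    {f : Rn n → ℂ} (hf : MemLp f 2) :
    MemLp (fun x : Rn n => ∫ u, K u * f (act (A u) x) ∂μ) 2 :=
  ⟨(aestronglyMeasurable_kernel_mul hA hdet hK hf.1).integral_prod_right',
    (eLpNorm_hausdorff_le hA hdet hK hf.1).trans_lt (ENNReal.mul_lt_top hK.2 hf.2)⟩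

theorem integral_hausdorff_congr (hA : ∀ k l, AEMeasurable (fun u => A u k l) μ)
    (hdet : ∀ᵐ u ∂μ, (A u).det ≠ 0) {f g : Rn n → ℂ} (h : f =ᵐ[volume] g) :
    ∀ᵐ x : Rn n, ∫ u, K u * f (act (A u) x) ∂μ = ∫ u, K u * g (act (A u) x) ∂μ := by
  filter_upwards [ae_ae_act hA hdet h] with x hx
  refine integral_congr_ae ?_
  filter_upwards [hx] with u hu
  rw [hu]

theorem existsUnique_isHausdorffOperator (hA : ∀ k l, AEMeasurable (fun u => A u k l) μ)
    (hdet : ∀ᵐ u ∂μ, (A u).det ≠ 0)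
    (hK : Integrable (fun u => ((|(A u).det| ^ (-(1 / 2) : ℝ) : ℝ) : ℂ) * K u) μ) :
    ∃! H : L2 n →L[ℂ] L2 n, IsHausdorffOperator μ K A H := by
  have hmem : ∀ f : L2 n, MemLp (fun x : Rn n => ∫ u, K u * f (act (A u) x) ∂μ) 2 volume :=
    fun f => memLp_hausdorff hA hdet hK (Lp.memLp f)
  let T : L2 n →ₗ[ℂ] L2 n :=
    { toFun := fun f => (hmem f).toLp
      map_add' := fun f g => by
        refine Lp.ext ?_
        filter_upwards [(hmem (f + g)).coeFn_toLp, (hmem f).coeFn_toLp, (hmem g).coeFn_toLp,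
          Lp.coeFn_add (hmem f).toLp (hmem g).toLp,
          integral_hausdorff_congr (K := K) hA hdet (Lp.coeFn_add f g),
          ae_integrable_hausdorff hA hdet hK (Lp.memLp f),
          ae_integrable_hausdorff hA hdet hK (Lp.memLp g)] with x h1 h2 h3 h4 h5 h6 h7
        rw [h1, h4, Pi.add_apply, h2, h3, h5, ← integral_add h6 h7]
        simp only [Pi.add_apply, mul_add]
      map_smul' := fun c f => by
        refine Lp.ext ?_
        filter_upwards [(hmem (c • f)).coeFn_toLp, (hmem f).coeFn_toLp,
          Lp.coeFn_smul c (hmem f).toLp,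
          integral_hausdorff_congr (K := K) hA hdet (Lp.coeFn_smul c f)] with x h1 h2 h4 h5
        simp only [RingHom.id_apply]
        rw [h1, h4, Pi.smul_apply, h2, h5, ← integral_smul]
        simp only [Pi.smul_apply, smul_eq_mul, mul_left_comm] }
  have hbound : ∀ f, ‖T f‖ ≤
      (∫⁻ u, ‖((|(A u).det| ^ (-(1 / 2) : ℝ) : ℝ) : ℂ) * K u‖ₑ ∂μ).toReal * ‖f‖ := by
    intro f
    rw [show T f = (hmem f).toLp from rfl, Lp.norm_toLp, Lp.norm_def, ← ENNReal.toReal_mul]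
    exact ENNReal.toReal_mono (ENNReal.mul_ne_top hK.2.ne (Lp.memLp f).2.ne)
      (eLpNorm_hausdorff_le hA hdet hK (Lp.memLp f).1)
  refine ⟨T.mkContinuous _ hbound, fun f hf => ⟨ae_integrable_hausdorff hA hdet hK hf, ?_⟩,
    fun H hH => ?_⟩
  · filter_upwards [(hmem hf.toLp).coeFn_toLp,
      integral_hausdorff_congr (K := K) hA hdet hf.coeFn_toLp] with x h1 h2
    rw [← h2]
    exact h1
  · refine ContinuousLinearMap.ext fun f => Lp.ext ?_
    filter_upwards [(hH f (Lp.memLp f)).2, (hmem f).coeFn_toLp] with x h1 h2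
    rw [Lp.toLp_coeFn] at h1
    rw [h1]
    exact h2.symm

/-- The weak form of the definition of a Hausdorff operator. -/
theorem IsHausdorffOperator.inner_eq (hA : ∀ k l, AEMeasurable (fun u => A u k l) μ)
    (hdet : ∀ᵐ u ∂μ, (A u).det ≠ 0)
    (hK : Integrable (fun u => ((|(A u).det| ^ (-(1 / 2) : ℝ) : ℝ) : ℂ) * K u) μ)
    {H : L2 n →L[ℂ] L2 n} (hH : IsHausdorffOperator μ K A H) (f g : L2 n) :
    inner ℂ g (H f) = ∫ u, K u * (∫ x : Rn n, inner ℂ (g x) (f (act (A u) x))) ∂μ := by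
  have hm := aestronglyMeasurable_kernel_mul hA hdet hK (Lp.memLp f).1
  have hint : Integrable (Function.uncurry fun (x : Rn n) u =>
      K u * f (act (A u) x) * starRingEnd ℂ (g x)) ((volume : Measure (Rn n)).prod μ) := by
    have hg : AEStronglyMeasurable (fun p : Rn n × Ω => starRingEnd ℂ (g p.1))
        ((volume : Measure (Rn n)).prod μ) :=
      (Complex.continuous_conj.comp_aestronglyMeasurable
        (Lp.memLp g).1).comp_quasiMeasurePreserving Measure.quasiMeasurePreserving_fst
    have hmg : AEStronglyMeasurable (Function.uncurry fun (x : Rn n) u =>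
      K u * f (act (A u) x) * starRingEnd ℂ (g x)) ((volume : Measure (Rn n)).prod μ) := hm.mul hg
    refine ⟨hmg, ?_⟩
    rw [hasFiniteIntegral_iff_enorm, lintegral_prod _ hmg.enorm]
    have h1 : ∀ x : Rn n, ∫⁻ u, ‖K u * f (act (A u) x) * starRingEnd ℂ (g x)‖ₑ ∂μ =
        (∫⁻ u, ‖K u * f (act (A u) x)‖ₑ ∂μ) * ‖g x‖ₑ := by
      intro x
      rw [← lintegral_mul_const' _ _ enorm_ne_top]
      refine lintegral_congr fun u => ?_
      rw [enorm_mul, RCLike.enorm_conj]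
    simp only [Function.uncurry_apply_pair, h1]
    -- Fubini is justified by Cauchy–Schwarz in `x`: the Hausdorff integral with absolute values
    -- inside is square integrable, and so is `g`.
    refine (ENNReal.lintegral_mul_le_Lp_mul_Lq volume Real.HolderConjugate.two_two
      hm.enorm.lintegral_prod_right' (Lp.memLp g).1.enorm).trans_lt ?_
    simp only [ENNReal.rpow_two]
    refine ENNReal.mul_lt_top (ENNReal.rpow_lt_top_of_nonneg (by norm_num) ?_)
      (ENNReal.rpow_lt_top_of_nonneg (by norm_num) (lintegral_sq_lt_top_of_memLp (Lp.memLp g)).ne)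
    exact ((lintegral_sq_lintegral_le hA hdet hK (Lp.memLp f).1).trans_lt
      (ENNReal.mul_lt_top (ENNReal.pow_lt_top hK.2)
        (lintegral_sq_lt_top_of_memLp (Lp.memLp f)))).ne
  calc inner ℂ g (H f) = ∫ x : Rn n, ∫ u, K u * f (act (A u) x) * starRingEnd ℂ (g x) ∂μ := by
        rw [L2.inner_def]
        refine integral_congr_ae ?_
        filter_upwards [(hH f (Lp.memLp f)).2] with x hx
        rw [Lp.toLp_coeFn] at hx
        rw [hx, RCLike.inner_apply, integral_mul_const]
    _ = ∫ u, (∫ x : Rn n, K u * f (act (A u) x) * starRingEnd ℂ (g x)) ∂μ :=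
        integral_integral_swap hint
    _ = _ := by
        simp_rw [mul_assoc, integral_const_mul, RCLike.inner_apply]

end Existence

/-! ### Logarithmic coordinates on the hyperoctants. -/

section Octants

variable {n : ℕ}

/-- The logarithmic coordinates on a hyperoctant. -/
def expCoord (σ : Fin n → ℤˣ) (t : Fin n → ℝ) : Fin n → ℝ :=
  fun k => ((σ k : ℤ) : ℝ) * Real.exp (-(2 * Real.pi) * t k)

theorem units_cast_mul_self (z : ℤˣ) : ((z : ℤ) : ℝ) * ((z : ℤ) : ℝ) = 1 := by
  rcases Int.units_eq_one_or z with h | h <;> simp [h]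

theorem abs_units_cast (z : ℤˣ) : |((z : ℤ) : ℝ)| = 1 := by
  rcases Int.units_eq_one_or z with h | h <;> simp [h]

theorem range_expCoord (σ : Fin n → ℤˣ) :
    Set.range (expCoord σ) = {y | ∀ k, 0 < ((σ k : ℤ) : ℝ) * y k} := by
  ext y
  constructor
  · rintro ⟨t, rfl⟩ k
    rw [expCoord, ← mul_assoc, units_cast_mul_self, one_mul]
    exact Real.exp_pos _
  · intro hy
    refine ⟨fun k => -(Real.log (((σ k : ℤ) : ℝ) * y k) / (2 * Real.pi)), funext fun k => ?_⟩
    have h : -(2 * Real.pi) * -(Real.log (((σ k : ℤ) : ℝ) * y k) / (2 * Real.pi)) =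
        Real.log (((σ k : ℤ) : ℝ) * y k) := by
      field_simp
    rw [expCoord, h, Real.exp_log (hy k), ← mul_assoc, units_cast_mul_self, one_mul]

theorem expCoord_injective (σ : Fin n → ℤˣ) : Function.Injective (expCoord σ) := by
  intro t t' h
  funext k
  have h1 := congrFun h k
  have h2 : ((σ k : ℤ) : ℝ) ≠ 0 := by simp
  have h3 := Real.exp_injective (mul_left_cancel₀ h2 h1)
  exact mul_left_cancel₀ (by simp [Real.pi_ne_zero]) h3

theorem hasFDerivAt_expCoord (σ : Fin n → ℤˣ) (t : Fin n → ℝ) :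
    HasFDerivAt (expCoord σ) (ContinuousLinearMap.pi fun k =>
      (((σ k : ℤ) : ℝ) * (Real.exp (-(2 * Real.pi) * t k) * -(2 * Real.pi))) •
        ContinuousLinearMap.proj (R := ℝ) (φ := fun _ : Fin n => ℝ) k) t := by
  rw [hasFDerivAt_pi]
  intro k
  have h1 : HasFDerivAt (fun x : Fin n → ℝ => x k)
    (ContinuousLinearMap.proj (R := ℝ) (φ := fun _ : Fin n => ℝ) k) t := hasFDerivAt_apply k t
  have h2 : HasDerivAt (fun r : ℝ => ((σ k : ℤ) : ℝ) * Real.exp (-(2 * Real.pi) * r))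
      (((σ k : ℤ) : ℝ) * (Real.exp (-(2 * Real.pi) * t k) * -(2 * Real.pi))) (t k) := by
    have := (((hasDerivAt_id (t k)).const_mul (-(2 * Real.pi))).exp).const_mul ((σ k : ℤ) : ℝ)
    simpa using this
  exact HasDerivAt.comp_hasFDerivAt
    (h₂ := fun r : ℝ => ((σ k : ℤ) : ℝ) * Real.exp (-(2 * Real.pi) * r))
    (f := fun x : Fin n → ℝ => x k) t h2 h1

theorem abs_det_fderiv_expCoord (σ : Fin n → ℤˣ) (t : Fin n → ℝ) :
    |(ContinuousLinearMap.pi fun k =>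
      (((σ k : ℤ) : ℝ) * (Real.exp (-(2 * Real.pi) * t k) * -(2 * Real.pi))) •
        ContinuousLinearMap.proj (R := ℝ) (φ := fun _ : Fin n => ℝ) k).det| =
      ∏ k, 2 * Real.pi * Real.exp (-(2 * Real.pi) * t k) := by
  have h : ((ContinuousLinearMap.pi fun k =>
      (((σ k : ℤ) : ℝ) * (Real.exp (-(2 * Real.pi) * t k) * -(2 * Real.pi))) •
        ContinuousLinearMap.proj (R := ℝ) (φ := fun _ : Fin n => ℝ) k :
        (Fin n → ℝ) →L[ℝ] (Fin n → ℝ)) : (Fin n → ℝ) →ₗ[ℝ] (Fin n → ℝ)) =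
      Matrix.toLin' (Matrix.diagonal fun k =>
        ((σ k : ℤ) : ℝ) * (Real.exp (-(2 * Real.pi) * t k) * -(2 * Real.pi))) := by
    refine LinearMap.ext fun x => funext fun k => ?_
    simp [Matrix.mulVec_diagonal]
  rw [ContinuousLinearMap.det, h, LinearMap.det_toLin', Matrix.det_diagonal, Finset.abs_prod]
  refine Finset.prod_congr rfl fun k _ => ?_
  rw [abs_mul, abs_units_cast, one_mul, abs_mul, abs_neg, abs_of_pos (Real.exp_pos _),
    abs_of_pos Real.two_pi_pos, mul_comm]

/-- The open hyperoctants are disjoint and cover the space up to the coordinate hyperplanes, which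
are null; on each one the change of variables formula applies. -/
theorem lintegral_eq_sum_expCoord {G : (Fin n → ℝ) → ENNReal} :
    ∫⁻ y, G y = ∑ σ : Fin n → ℤˣ, ∫⁻ t : Fin n → ℝ,
      ENNReal.ofReal (∏ k, 2 * Real.pi * Real.exp (-(2 * Real.pi) * t k)) * G (expCoord σ t) := by
  have hmeas : ∀ σ : Fin n → ℤˣ, MeasurableSet (Set.range (expCoord σ)) := by
    intro σ
    rw [range_expCoord, Set.ofPred_forall]
    exact MeasurableSet.iInter fun k => measurableSet_lt measurable_const (by fun_prop)
  have hdisj : Pairwise (Function.onFun Disjoint fun σ : Fin n → ℤˣ => Set.range (expCoord σ)) := by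
    intro σ σ' hne
    refine Set.disjoint_left.2 fun y h1 h2 => hne ?_
    simp only [range_expCoord] at h1 h2
    funext k
    have hk1 := h1 k
    have hk2 := h2 k
    rcases Int.units_eq_one_or (σ k) with h | h <;>
    rcases Int.units_eq_one_or (σ' k) with h' | h' <;> simp [h, h'] at hk1 hk2 ⊢ <;> linarith
  have hae : ∀ᵐ y : Fin n → ℝ, y ∈ ⋃ σ : Fin n → ℤˣ, Set.range (expCoord σ) := by
    have h0 : ∀ᵐ y : Fin n → ℝ, ∀ k, y k ≠ 0 :=
      ae_all_iff.2 fun k => by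
        have := Measure.pi_hyperplane (fun _ : Fin n => (volume : Measure ℝ)) k 0
        simpa [ae_iff, volume_pi] using this
    filter_upwards [h0] with y hy
    refine Set.mem_iUnion.2 ⟨fun k => if 0 < y k then 1 else -1, ?_⟩
    rw [range_expCoord]
    intro k
    rcases lt_or_gt_of_ne (hy k) with h | h
    · simp [h.not_gt, h]
    · simp [h]
  conv_lhs => rw [← Measure.restrict_eq_self_of_ae_mem hae]
  rw [lintegral_iUnion hmeas hdisj, tsum_fintype]
  refine Finset.sum_congr rfl fun σ _ => ?_
  rw [← Set.image_univ, lintegral_image_eq_lintegral_abs_det_fderiv_mul volume MeasurableSet.univ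
    (fun t _ => (hasFDerivAt_expCoord σ t).hasFDerivWithinAt) (expCoord_injective σ).injOn]
  simp only [abs_det_fderiv_expCoord, Measure.restrict_univ]

/-- The square root of the Jacobian of the logarithmic coordinates. -/
def sqrtJac (t : Rn n) : ℝ := ∏ k, Real.sqrt (2 * Real.pi) * Real.exp (-Real.pi * t k)

theorem sqrtJac_pos (t : Rn n) : 0 < sqrtJac t :=
  Finset.prod_pos fun k _ => by positivity

theorem sqrtJac_sq (t : Rn n) :
    sqrtJac t ^ 2 = ∏ k, 2 * Real.pi * Real.exp (-(2 * Real.pi) * t k) := by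
  rw [sqrtJac, ← Finset.prod_pow]
  refine Finset.prod_congr rfl fun k _ => ?_
  rw [mul_pow, Real.sq_sqrt (by positivity), ← Real.exp_nat_mul]
  congr 2
  push_cast
  ring

theorem continuous_sqrtJac : Continuous (sqrtJac : Rn n → ℝ) := by
  unfold sqrtJac
  fun_prop

/-- Logarithmic coordinates on the image of a hyperoctant under `C`. -/
def octParam (C : Matrix (Fin n) (Fin n) ℝ) (σ : Fin n → ℤˣ) (t : Rn n) : Rn n :=
  act C (WithLp.toLp 2 (expCoord σ t))

theorem measurable_octParam (C : Matrix (Fin n) (Fin n) ℝ) (σ : Fin n → ℤˣ) :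
    Measurable (octParam C σ) := by
  refine (measurable_act C).comp ((PiLp.continuous_toLp 2 _).measurable.comp
    (measurable_pi_lambda _ fun k => ?_))
  unfold expCoord
  fun_prop

theorem abs_det_of_mem_orthogonalGroup {C : Matrix (Fin n) (Fin n) ℝ}
    (hC : C ∈ Matrix.orthogonalGroup (Fin n) ℝ) : |C.det| = 1 := by
  have h := congrArg Matrix.det ((Matrix.mem_orthogonalGroup_iff' _ _).1 hC)
  rw [Matrix.det_mul, Matrix.det_transpose, Matrix.det_one, ← abs_mul_abs_self] at h
  nlinarith [abs_nonneg C.det]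

theorem lintegral_eq_sum_octParam {C : Matrix (Fin n) (Fin n) ℝ}
    (hC : C ∈ Matrix.orthogonalGroup (Fin n) ℝ) {F : Rn n → ENNReal} (hF : Measurable F) :
    ∫⁻ x, F x = ∑ σ : Fin n → ℤˣ, ∫⁻ t : Rn n,
      ENNReal.ofReal (sqrtJac t ^ 2) * F (octParam C σ t) := by
  have hdet := abs_det_of_mem_orthogonalGroup hC
  have h1 : ∫⁻ x, F x = ∫⁻ x, F (act C x) := by
    rw [lintegral_comp_act (by rw [← abs_pos, hdet]; exact one_pos) hF.aemeasurable, hdet]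
    simp
  have hm : Measurable fun x => F (act C x) := hF.comp (measurable_act C)
  rw [h1, ← (PiLp.volume_preserving_toLp (Fin n)).lintegral_comp hm, lintegral_eq_sum_expCoord]
  refine Finset.sum_congr rfl fun σ _ => ?_
  rw [← (PiLp.volume_preserving_toLp (Fin n)).lintegral_comp]
  · simp only [sqrtJac_sq, octParam]
  · exact (continuous_sqrtJac.measurable.pow_const 2).ennreal_ofReal.mul
      (hF.comp (measurable_octParam C σ))

/-- The sum formula for the indicator of a null set has only zero summands, and the Jacobian is
positive. Consequently `octMap` respects almost everywhere equality. -/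
theorem quasiMeasurePreserving_octParam {C : Matrix (Fin n) (Fin n) ℝ}
    (hC : C ∈ Matrix.orthogonalGroup (Fin n) ℝ) (σ : Fin n → ℤˣ) :
    Measure.QuasiMeasurePreserving (octParam C σ) volume volume := by
  refine ⟨measurable_octParam C σ, Measure.AbsolutelyContinuous.mk fun s hs h0 => ?_⟩
  rw [Measure.map_apply (measurable_octParam C σ) hs]
  have h1 := lintegral_eq_sum_octParam hC (measurable_one.indicator hs)
  rw [lintegral_indicator_one hs, h0, eq_comm, Finset.sum_eq_zero_iff] at h1
  have hm : Measurable fun t : Rn n => ENNReal.ofReal (sqrtJac t ^ 2) *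
      s.indicator (1 : Rn n → ENNReal) (octParam C σ t) :=
    (continuous_sqrtJac.measurable.pow_const 2).ennreal_ofReal.mul
      ((measurable_one.indicator hs).comp (measurable_octParam C σ))
  have h2 := (lintegral_eq_zero_iff hm).1 (h1 σ (Finset.mem_univ σ))
  rw [measure_eq_zero_iff_ae_notMem]
  filter_upwards [h2] with t ht hmem
  have hpos := sqrtJac_pos t
  have hmem' : octParam C σ t ∈ s := hmem
  rw [Set.indicator_of_mem hmem', Pi.one_apply, mul_one, Pi.zero_apply,
    ENNReal.ofReal_eq_zero] at ht
  exact absurd ht (not_le.2 (by positivity))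

end Octants

/-! ### The unitary onto vector-valued L², and dilations as translations. -/

section OctantTransform

variable {n : ℕ} {C : Matrix (Fin n) (Fin n) ℝ} {e : Fin (2 ^ n) ≃ (Fin n → ℤˣ)}

theorem enorm_sq_eq_sum {ι : Type*} [Fintype ι] (v : EuclideanSpace ℂ ι) :
    ‖v‖ₑ ^ 2 = ∑ i, ‖v i‖ₑ ^ 2 := by
  simp only [← ofReal_norm]
  rw [← ENNReal.ofReal_pow (norm_nonneg _), EuclideanSpace.norm_sq_eq,
    ENNReal.ofReal_sum_of_nonneg fun i _ => sq_nonneg _]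
  simp only [ENNReal.ofReal_pow (norm_nonneg _)]

/-- The function `f` in logarithmic coordinates on all the (rotated) hyperoctants. -/
def octMap (C : Matrix (Fin n) (Fin n) ℝ) (e : Fin (2 ^ n) ≃ (Fin n → ℤˣ)) (f : Rn n → ℂ)
    (t : Rn n) : Cpow n :=
  WithLp.toLp 2 fun i => (sqrtJac t : ℂ) * f (octParam C (e i) t)

/-- The inverse of `octMap`. -/
def octInv (C : Matrix (Fin n) (Fin n) ℝ) (e : Fin (2 ^ n) ≃ (Fin n → ℤˣ)) (g : Rn n → Cpow n)
    (x : Rn n) : ℂ :=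
  ∑ i, (octant (e i)).indicator (fun y =>
    ((sqrtJac (WithLp.toLp 2 fun k => -(Real.log |y k| / (2 * Real.pi))) : ℝ) : ℂ)⁻¹ *
      g (WithLp.toLp 2 fun k => -(Real.log |y k| / (2 * Real.pi))) i) (act Cᵀ x)

theorem measurable_octMap {f : Rn n → ℂ} (hf : Measurable f) : Measurable (octMap C e f) := by
  refine (PiLp.continuous_toLp 2 _).measurable.comp (measurable_pi_lambda _ fun i => ?_)
  exact (Complex.continuous_ofReal.measurable.comp continuous_sqrtJac.measurable).mul
    (hf.comp (measurable_octParam C (e i)))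

theorem measurable_octInv {g : Rn n → Cpow n} (hg : Measurable g) :
    Measurable (octInv C e g) := by
  have hlog : Measurable fun y : Rn n =>
      (WithLp.toLp 2 fun k => -(Real.log |y k| / (2 * Real.pi)) : Rn n) :=
    (PiLp.continuous_toLp 2 _).measurable.comp (measurable_pi_lambda _ fun k => by fun_prop)
  unfold octInv
  refine Finset.measurable_sum _ fun i _ => ?_
  refine Measurable.comp (Measurable.indicator ?_ ?_) (measurable_act _)
  · refine ((Complex.continuous_ofReal.measurable.comp
      (continuous_sqrtJac.measurable.comp hlog)).inv).mul ?_
    have : Measurable fun v : Cpow n => v i := by fun_prop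
    exact this.comp (hg.comp hlog)
  · simp only [octant, Set.ofPred_forall]
    exact MeasurableSet.iInter fun k => measurableSet_lt measurable_const (by fun_prop)

theorem octInv_octParam (hC : C ∈ Matrix.orthogonalGroup (Fin n) ℝ) (g : Rn n → Cpow n)
    (i : Fin (2 ^ n)) (t : Rn n) :
    octInv C e g (octParam C (e i) t) = (sqrtJac t : ℂ)⁻¹ * g t i := by
  have h1 : act Cᵀ (octParam C (e i) t) = WithLp.toLp 2 (expCoord (e i) t) := by
    rw [octParam, act_act, (Matrix.mem_orthogonalGroup_iff' _ _).1 hC]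
    simp [act]
  have h2 : (WithLp.toLp 2 fun k => -(Real.log |expCoord (e i) t k| / (2 * Real.pi)) : Rn n)
      = t := by
    ext k
    simp only [expCoord, abs_mul, abs_units_cast, one_mul, Real.abs_exp, Real.log_exp]
    field_simp
  have h3 : ∀ j, (WithLp.toLp 2 (expCoord (e i) t) : Rn n) ∈ octant (e j) ↔ j = i := by
    intro j
    constructor
    · intro h
      refine e.injective (funext fun k => ?_)
      have hk := h k
      simp only [expCoord] at hk
      have hpos := Real.exp_pos (-(2 * Real.pi * t k))
      rcases Int.units_eq_one_or (e i k) with h4 | h4 <;>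
      rcases Int.units_eq_one_or (e j k) with h5 | h5 <;> simp [h4, h5] at hk ⊢ <;> linarith
    · rintro rfl k
      simp only [expCoord]
      rw [← mul_assoc, units_cast_mul_self, one_mul]
      exact Real.exp_pos _
  rw [octInv, h1, Finset.sum_eq_single i]
  · rw [Set.indicator_of_mem ((h3 i).2 rfl)]
    simp only [h2]
  · intro j _ hj
    rw [Set.indicator_of_notMem (fun h => hj ((h3 j).1 h))]
  · simp

/-- The identity is pointwise, with no null set, because `octParam` never meets the rotated
coordinate hyperplanes. It yields surjectivity. -/
theorem octMap_octInv (hC : C ∈ Matrix.orthogonalGroup (Fin n) ℝ) (g : Rn n → Cpow n) :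
    octMap C e (octInv C e g) = g := by
  funext t
  ext i
  have h : (sqrtJac t : ℂ) ≠ 0 := Complex.ofReal_ne_zero.2 (sqrtJac_pos t).ne'
  simp only [octMap, octInv_octParam hC]
  rw [mul_inv_cancel_left₀ h]

theorem lintegral_enorm_sq_octMap (hC : C ∈ Matrix.orthogonalGroup (Fin n) ℝ) {f : Rn n → ℂ}
    (hf : Measurable f) : ∫⁻ t, ‖octMap C e f t‖ₑ ^ 2 = ∫⁻ x, ‖f x‖ₑ ^ 2 := by
  rw [lintegral_eq_sum_octParam hC (hf.enorm.pow_const 2), ← Equiv.sum_comp e,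
    ← lintegral_finsetSum]
  · refine lintegral_congr fun t => ?_
    rw [enorm_sq_eq_sum]
    refine Finset.sum_congr rfl fun i _ => ?_
    simp only [octMap]
    rw [enorm_mul, mul_pow, ← ofReal_norm (sqrtJac t : ℂ),
      Complex.norm_of_nonneg (sqrtJac_pos t).le, ENNReal.ofReal_pow (sqrtJac_pos t).le]
  · intro i _
    exact (continuous_sqrtJac.measurable.pow_const 2).ennreal_ofReal.mul
      ((hf.comp (measurable_octParam C (e i))).enorm.pow_const 2)

theorem octMap_congr_ae (hC : C ∈ Matrix.orthogonalGroup (Fin n) ℝ) {f g : Rn n → ℂ}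
    (h : f =ᵐ[volume] g) : octMap C e f =ᵐ[volume] octMap C e g := by
  have : ∀ᵐ t : Rn n, ∀ i, f (octParam C (e i) t) = g (octParam C (e i) t) :=
    ae_all_iff.2 fun i => (quasiMeasurePreserving_octParam hC (e i)).ae h
  filter_upwards [this] with t ht
  simp only [octMap, ht]

theorem memLp_two_of_lintegral {α E : Type*} [MeasurableSpace α] [NormedAddCommGroup E]
    {ν : Measure α} {f : α → E} (hf : AEStronglyMeasurable f ν) (h : ∫⁻ x, ‖f x‖ₑ ^ 2 ∂ν < ⊤) :
    MemLp f 2 ν :=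
  ⟨hf, (eLpNorm_lt_top_iff_lintegral_rpow_enorm_lt_top (by norm_num) (by norm_num)).2
    (by simpa using h)⟩

theorem memLp_octMap (hC : C ∈ Matrix.orthogonalGroup (Fin n) ℝ) (f : L2 n) :
    MemLp (octMap C e f) 2 volume := by
  have hf := (Lp.stronglyMeasurable f).measurable
  refine memLp_two_of_lintegral (measurable_octMap hf).aestronglyMeasurable ?_
  rw [lintegral_enorm_sq_octMap hC hf]
  exact lintegral_sq_lt_top_of_memLp (Lp.memLp f)

theorem exists_octEquiv (hC : C ∈ Matrix.orthogonalGroup (Fin n) ℝ)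
    (e : Fin (2 ^ n) ≃ (Fin n → ℤˣ)) :
    ∃ T : L2 n ≃ₗᵢ[ℂ] L2vec n, ∀ f : L2 n, T f =ᵐ[volume] octMap C e f := by
  let T : L2 n →ₗ[ℂ] L2vec n :=
    { toFun := fun f => (memLp_octMap (e := e) hC f).toLp
      map_add' := fun f g => by
        refine Lp.ext ?_
        filter_upwards [(memLp_octMap (e := e) hC (f + g)).coeFn_toLp,
          (memLp_octMap (e := e) hC f).coeFn_toLp, (memLp_octMap (e := e) hC g).coeFn_toLp,
          Lp.coeFn_add (memLp_octMap (e := e) hC f).toLp (memLp_octMap (e := e) hC g).toLp,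
          octMap_congr_ae (e := e) hC (Lp.coeFn_add f g)] with t h1 h2 h3 h4 h5
        rw [h1, h4, Pi.add_apply, h2, h3, h5]
        ext i
        simp [octMap, mul_add]
      map_smul' := fun c f => by
        refine Lp.ext ?_
        simp only [RingHom.id_apply]
        filter_upwards [(memLp_octMap (e := e) hC (c • f)).coeFn_toLp,
          (memLp_octMap (e := e) hC f).coeFn_toLp,
          Lp.coeFn_smul c (memLp_octMap (e := e) hC f).toLp,
          octMap_congr_ae (e := e) hC (Lp.coeFn_smul c f)] with t h1 h2 h4 h5
        rw [h1, h4, Pi.smul_apply, h2, h5]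
        ext i
        simp [octMap, mul_left_comm] }
  let I : L2 n →ₗᵢ[ℂ] L2vec n :=
    { T with
      norm_map' := fun f => by
        have h : T f = (memLp_octMap (e := e) hC f).toLp := rfl
        rw [h, Lp.norm_toLp, Lp.norm_def, eLpNorm_two_eq, eLpNorm_two_eq,
          lintegral_enorm_sq_octMap hC (Lp.stronglyMeasurable f).measurable] }
  have hsurj : Function.Surjective I := by
    intro g
    have hg := (Lp.stronglyMeasurable g).measurable
    have hm := measurable_octInv (C := C) (e := e) hg
    have hmem : MemLp (octInv C e g) 2 volume := by
      refine memLp_two_of_lintegral hm.aestronglyMeasurable ?_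
      -- The isometry is read backwards: `octInv C e g` has the L² norm of its image, which is `g`.
      rw [← lintegral_enorm_sq_octMap (e := e) hC hm, octMap_octInv hC]
      exact lintegral_sq_lt_top_of_memLp (Lp.memLp g)
    refine ⟨hmem.toLp, Lp.ext ?_⟩
    have h1 := octMap_congr_ae (e := e) hC hmem.coeFn_toLp
    rw [octMap_octInv hC] at h1
    exact (memLp_octMap (e := e) hC hmem.toLp).coeFn_toLp.trans h1
  exact ⟨LinearIsometryEquiv.ofSurjective I hsurj,
    fun f => (memLp_octMap (e := e) hC f).coeFn_toLp⟩

/-- The dilation by `a` in logarithmic coordinates is a translation by `logShift a`. -/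
def logShift (a : Fin n → ℝ) : Rn n := WithLp.toLp 2 fun k => -(Real.log |a k| / (2 * Real.pi))

/-- The change of the half-density under translation is the source of the exponent `-1/2` in the
symbol. -/
theorem sqrtJac_add_logShift {a : Fin n → ℝ} (ha : ∀ k, a k ≠ 0) (t : Rn n) :
    sqrtJac t = (∏ k, |a k|) ^ (-(1 / 2) : ℝ) * sqrtJac (t + logShift a) := by
  rw [sqrtJac, sqrtJac, ← Real.finsetProd_rpow _ _ (fun k _ => abs_nonneg _),
    ← Finset.prod_mul_distrib]
  refine Finset.prod_congr rfl fun k _ => ?_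
  rw [Real.rpow_def_of_pos (abs_pos.2 (ha k)), mul_left_comm, ← Real.exp_add]
  congr 2
  simp only [logShift, PiLp.add_apply]
  field_simp
  ring

/-- Writing `a k = τ k * exp (log |a k|)`, the sign changes the hyperoctant and the exponential is
absorbed into the shift. -/
theorem diagonal_mulVec_expCoord {a : Fin n → ℝ} (ha : ∀ k, a k ≠ 0) {τ : Fin n → ℤˣ}
    (hτ : ∀ k, Real.sign (a k) = ((τ k : ℤ) : ℝ)) (σ : Fin n → ℤˣ) (t : Rn n) :
    Matrix.diagonal a *ᵥ expCoord σ t = expCoord (σ * τ) (WithLp.ofLp (t + logShift a)) := by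
  funext k
  have h1 : a k = ((τ k : ℤ) : ℝ) * Real.exp (Real.log |a k|) := by
    rw [Real.exp_log (abs_pos.2 (ha k)), ← hτ]
    rcases lt_or_gt_of_ne (ha k) with h | h
    · simp [Real.sign_of_neg h, abs_of_neg h]
    · simp [Real.sign_of_pos h, abs_of_pos h]
  rw [Matrix.mulVec_diagonal, expCoord, expCoord]
  nth_rewrite 1 [h1]
  have h2 : -(2 * Real.pi) * (t + logShift a) k =
      Real.log |a k| + -(2 * Real.pi) * t k := by
    simp only [logShift, PiLp.add_apply]
    field_simp
    ring
  rw [h2, Real.exp_add]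
  simp only [Pi.mul_apply, Units.val_mul, Int.cast_mul]
  ring

theorem octMap_comp_act {Ω : Type*} {A : Ω → Matrix (Fin n) (Fin n) ℝ} (hC : Diagonalizes C A)
    {u : Ω} (hu : (A u).det ≠ 0) {τ : Fin n → ℤˣ}
    (hτ : ∀ k, Real.sign (diagEntry C A u k) = ((τ k : ℤ) : ℝ)) (f : Rn n → ℂ) (t : Rn n)
    (i : Fin (2 ^ n)) :
    octMap C e (fun x => f (act (A u) x)) t i = ((|(A u).det| ^ (-(1 / 2) : ℝ) : ℝ) : ℂ) *
      octMap C e f (t + logShift (diagEntry C A u)) (e.symm (e i * τ)) := by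
  have ha := hC.diagEntry_ne_zero hu
  have h : act (A u) (octParam C (e i) t) =
      octParam C (e i * τ) (t + logShift (diagEntry C A u)) := by
    rw [octParam, act_act, hC.mul_eq, ← act_act, octParam]
    congr 1
    exact congrArg (WithLp.toLp 2) (diagonal_mulVec_expCoord ha hτ (e i) t)
  simp only [octMap, h, Equiv.apply_symm_apply]
  rw [sqrtJac_add_logShift ha t, hC.abs_det_eq]
  push_cast
  ring

end OctantTransform

/-! ### Matrix multipliers and the Fourier transform of translations. -/

section Multiplication

variable {n : ℕ} {Ψ : Rn n → Matrix (Fin (2 ^ n)) (Fin (2 ^ n)) ℂ}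

/-- A crude bound through the ℓ¹ norm; only its uniformity in `s` matters later. -/
theorem norm_toLp_mulVec_le {ι : Type*} [Fintype ι] {P : Matrix ι ι ℂ} {c : ℝ}
    (hP : ∀ i j, ‖P i j‖ ≤ c) (v : EuclideanSpace ℂ ι) :
    ‖(WithLp.toLp 2 (P *ᵥ WithLp.ofLp v) : EuclideanSpace ℂ ι)‖ ≤
      Fintype.card ι * (Fintype.card ι * c) * ‖v‖ := by
  have h1 : ∀ i, ‖(P *ᵥ WithLp.ofLp v) i‖ ≤ Fintype.card ι * (c * ‖v‖) := by
    intro i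
    refine (norm_sum_le _ _).trans ((Finset.sum_le_card_nsmul _ _ (c * ‖v‖) fun j _ => ?_).trans
      (by simp))
    rw [norm_mul]
    exact mul_le_mul (hP i j) (PiLp.norm_apply_le v j) (norm_nonneg _)
      ((norm_nonneg _).trans (hP i j))
  have h2 : ‖(WithLp.toLp 2 (P *ᵥ WithLp.ofLp v) : EuclideanSpace ℂ ι)‖ ≤
      ∑ i, ‖(P *ᵥ WithLp.ofLp v) i‖ := by
    refine abs_le_of_sq_le_sq' ?_ (Finset.sum_nonneg fun i _ => norm_nonneg _) |>.2
    rw [EuclideanSpace.norm_sq_eq]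
    exact Finset.sum_sq_le_sq_sum_of_nonneg fun i _ => norm_nonneg _
  refine h2.trans ((Finset.sum_le_card_nsmul _ _ _ fun i _ => h1 i).trans ?_)
  rw [nsmul_eq_mul, Finset.card_univ]
  exact le_of_eq (by ring)

theorem aestronglyMeasurable_mulVec (hm : ∀ i j, AEStronglyMeasurable fun s => Ψ s i j)
    {g : Rn n → Cpow n} (hg : AEStronglyMeasurable g) :
    AEStronglyMeasurable fun s => (WithLp.toLp 2 (Ψ s *ᵥ WithLp.ofLp (g s)) : Cpow n) := by
  refine (PiLp.continuous_toLp 2 _).comp_aestronglyMeasurable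
    (AEMeasurable.aestronglyMeasurable (aemeasurable_pi_iff.2 fun i => ?_))
  simp only [Matrix.mulVec, dotProduct]
  refine Finset.aemeasurable_fun_sum _ fun j _ => (hm i j).aemeasurable.mul ?_
  have : Measurable fun v : Cpow n => v j := by fun_prop
  exact this.comp_aemeasurable hg.aemeasurable

theorem exists_isMultiplicationOperator (hm : ∀ i j, AEStronglyMeasurable fun s => Ψ s i j)
    {c : ℝ} (hc : ∀ s i j, ‖Ψ s i j‖ ≤ c) :
    ∃ M : L2vec n →L[ℂ] L2vec n, IsMultiplicationOperator Ψ M := by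
  have hle : ∀ g : L2vec n, ∀ s, ‖(WithLp.toLp 2 (Ψ s *ᵥ WithLp.ofLp (g s)) : Cpow n)‖ ≤
      Fintype.card (Fin (2 ^ n)) * (Fintype.card (Fin (2 ^ n)) * c) * ‖g s‖ :=
    fun g s => norm_toLp_mulVec_le (hc s) _
  have hmem : ∀ g : L2vec n,
      MemLp (fun s => (WithLp.toLp 2 (Ψ s *ᵥ WithLp.ofLp (g s)) : Cpow n)) 2 volume :=
    fun g => (Lp.memLp g).of_le_mul (aestronglyMeasurable_mulVec hm (Lp.memLp g).1)
      (Filter.Eventually.of_forall (hle g))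
  let T : L2vec n →ₗ[ℂ] L2vec n :=
    { toFun := fun g => (hmem g).toLp
      map_add' := fun f g => by
        refine Lp.ext ?_
        filter_upwards [(hmem (f + g)).coeFn_toLp, (hmem f).coeFn_toLp, (hmem g).coeFn_toLp,
          Lp.coeFn_add (hmem f).toLp (hmem g).toLp, Lp.coeFn_add f g] with s h1 h2 h3 h4 h5
        rw [h1, h4, Pi.add_apply, h2, h3, h5]
        simp [Matrix.mulVec_add]
      map_smul' := fun c f => by
        refine Lp.ext ?_
        simp only [RingHom.id_apply]
        filter_upwards [(hmem (c • f)).coeFn_toLp, (hmem f).coeFn_toLp,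
          Lp.coeFn_smul c (hmem f).toLp, Lp.coeFn_smul c f] with s h1 h2 h4 h5
        rw [h1, h4, Pi.smul_apply, h2, h5]
        simp [Matrix.mulVec_smul] }
  refine ⟨T.mkContinuous (Fintype.card (Fin (2 ^ n)) * (Fintype.card (Fin (2 ^ n)) * c))
    fun g => ?_, fun g => (hmem g).coeFn_toLp⟩
  refine Lp.norm_le_mul_norm_of_ae_le_mul ?_
  filter_upwards [(hmem g).coeFn_toLp] with s hs
  rw [show (T g : Rn n → Cpow n) s = _ from hs]
  exact hle g s

theorem IsMultiplicationOperator.unique {M M' : L2vec n →L[ℂ] L2vec n}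
    (h : IsMultiplicationOperator Ψ M) (h' : IsMultiplicationOperator Ψ M') : M = M' := by
  refine ContinuousLinearMap.ext fun g => Lp.ext ?_
  filter_upwards [h g, h' g] with s h1 h2
  rw [h1, h2]

theorem IsMultiplicationOperator.comp {Ψ' : Rn n → Matrix (Fin (2 ^ n)) (Fin (2 ^ n)) ℂ}
    {M M' : L2vec n →L[ℂ] L2vec n}
    (h : IsMultiplicationOperator Ψ M) (h' : IsMultiplicationOperator Ψ' M') :
    IsMultiplicationOperator (fun s => Ψ s * Ψ' s) (M ∘L M') := by
  intro g
  filter_upwards [h (M' g), h' g] with s h1 h2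
  rw [ContinuousLinearMap.comp_apply, h1, h2, Matrix.mulVec_mulVec]

open FourierTransform in
theorem fourier_postcomp_translate {E F : Type*} [NormedAddCommGroup E] [InnerProductSpace ℝ E]
    [FiniteDimensional ℝ E] [MeasurableSpace E] [BorelSpace E] [NormedAddCommGroup F]
    [NormedSpace ℂ F] [CompleteSpace F] (L : F →L[ℂ] F) {φ : E → F} (hφ : Integrable φ)
    (τ s : E) :
    𝓕 (fun t => L (φ (t + τ))) s =
      ((Real.fourierChar (inner ℝ τ s) : Circle) : ℂ) • L (𝓕 φ s) := by
  rw [Real.fourier_eq, Real.fourier_eq,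
    ← L.integral_comp_comm ((Real.fourierIntegral_convergent_iff s).2 hφ),
    ← integral_smul, ← integral_add_right_eq_self _ (-τ)]
  refine integral_congr_ae (Filter.Eventually.of_forall fun t => ?_)
  have h : -inner ℝ (t + -τ) s = inner ℝ τ s + -inner ℝ t s := by
    rw [inner_add_left, inner_neg_left]
    ring
  simp only [neg_add_cancel_right, h, Circle.smul_def, L.map_smul, AddChar.map_add_eq_mul,
    mul_smul]

-- Both sides are continuous in `g`, so it is enough to check Schwartz functions. There the L²
-- Fourier transform is the Fourier integral, and a substitution produces the character.
set_option maxHeartbeats 1600000 in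
open FourierTransform in
theorem fourier_translate_matrix (P : Matrix (Fin (2 ^ n)) (Fin (2 ^ n)) ℂ) (τ : Rn n)
    {g h : L2vec n}
    (hh : h =ᵐ[volume] fun t => WithLp.toLp 2 (P *ᵥ WithLp.ofLp (g (t + τ)))) :
    Lp.fourierTransformₗᵢ (Rn n) (Cpow n) h =ᵐ[volume] fun s => WithLp.toLp 2
      ((((Real.fourierChar (inner ℝ τ s) : Circle) : ℂ) • P) *ᵥ
        WithLp.ofLp (Lp.fourierTransformₗᵢ (Rn n) (Cpow n) g s)) := by
  have hτ : MeasurePreserving (fun t : Rn n => t + τ) volume volume :=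
    measurePreserving_add_right volume τ
  let L : Cpow n →L[ℂ] Cpow n := LinearMap.toContinuousLinearMap P.toEuclideanLin
  have hL : ∀ v, L v = WithLp.toLp 2 (P *ᵥ WithLp.ofLp v) := fun v => by
    simp [L, Matrix.toLpLin_apply]
  let S : L2vec n →L[ℂ] L2vec n := L.compLpL 2 volume ∘L
    (Lp.compMeasurePreservingₗᵢ ℂ (fun t : Rn n => t + τ) hτ).toContinuousLinearMap
  have hS : ∀ f : L2vec n, S f =ᵐ[volume] fun t => L (f (t + τ)) := by
    intro f
    refine (L.coeFn_compLpL (p := 2) _).trans ?_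
    filter_upwards [Lp.coeFn_compMeasurePreserving f hτ] with t ht
    exact congrArg L ht
  obtain ⟨M, hM⟩ : ∃ M : L2vec n →L[ℂ] L2vec n, IsMultiplicationOperator
      (fun s => ((Real.fourierChar (inner ℝ τ s) : Circle) : ℂ) • P) M := by
    have hcont : Continuous fun s : Rn n => ((Real.fourierChar (inner ℝ τ s) : Circle) : ℂ) := by
      fun_prop
    refine exists_isMultiplicationOperator (c := ∑ i, ∑ j, ‖P i j‖)
      (fun i j => (hcont.mul continuous_const).aestronglyMeasurable) fun s i j => ?_
    rw [Matrix.smul_apply, norm_smul, Circle.norm_coe, one_mul]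
    exact (Finset.single_le_sum (f := fun j => ‖P i j‖) (fun j _ => norm_nonneg _)
      (Finset.mem_univ j)).trans (Finset.single_le_sum (f := fun i => ∑ j, ‖P i j‖)
        (fun i _ => Finset.sum_nonneg fun j _ => norm_nonneg _) (Finset.mem_univ i))
  have key : ∀ f : L2vec n, Lp.fourierTransformₗᵢ (Rn n) (Cpow n) (S f) =
      M (Lp.fourierTransformₗᵢ (Rn n) (Cpow n) f) := by
    intro f
    refine DenseRange.induction_on
      (p := fun f : L2vec n => Lp.fourierTransformₗᵢ (Rn n) (Cpow n) (S f) =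
        M (Lp.fourierTransformₗᵢ (Rn n) (Cpow n) f))
      (SchwartzMap.denseRange_toLpCLM (p := 2) ENNReal.ofNat_ne_top) f
      (isClosed_eq (by fun_prop) (by fun_prop)) fun φ => ?_
    -- Subtracting `-τ` is the translation by `+τ`.
    let ψ : SchwartzMap (Rn n) (Cpow n) := (φ.compSubConstCLM ℂ (-τ)).postcompCLM L
    have hψfun : (ψ : Rn n → Cpow n) = fun t => L (φ (t + τ)) := by
      funext t
      simp [ψ]
    have hψ : S (SchwartzMap.toLpCLM ℝ (Cpow n) 2 volume φ) = ψ.toLp 2 := by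
      refine Lp.ext ?_
      filter_upwards [hS (SchwartzMap.toLpCLM ℝ (Cpow n) 2 volume φ), ψ.coeFn_toLp 2 volume,
        hτ.quasiMeasurePreserving.ae (φ.coeFn_toLp 2 volume)] with t h1 h2 h3
      rw [h1, h2, SchwartzMap.toLpCLM_apply, h3]
      simp [ψ]
    rw [hψ]
    have h1 : Lp.fourierTransformₗᵢ (Rn n) (Cpow n) (ψ.toLp 2) = (𝓕 ψ).toLp 2 :=
      SchwartzMap.toLp_fourier_eq ψ
    have h2 : Lp.fourierTransformₗᵢ (Rn n) (Cpow n) (φ.toLp 2) = (𝓕 φ).toLp 2 :=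
      SchwartzMap.toLp_fourier_eq φ
    rw [h1, SchwartzMap.toLpCLM_apply, h2]
    refine Lp.ext ?_
    filter_upwards [hM ((𝓕 φ).toLp 2), (𝓕 φ).coeFn_toLp 2 volume, (𝓕 ψ).coeFn_toLp 2 volume]
      with s h3 h4 h5
    have h6 : (𝓕 ψ) s = ((Real.fourierChar (inner ℝ τ s) : Circle) : ℂ) • L ((𝓕 φ) s) := by
      rw [SchwartzMap.fourier_coe, SchwartzMap.fourier_coe, ← fourier_postcomp_translate L
        φ.integrable, ← hψfun]
    rw [h3, h4, h5, h6, Matrix.smul_mulVec, WithLp.toLp_smul, ← hL]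
  have hhS : h = S g := by
    refine Lp.ext (hh.trans ?_)
    filter_upwards [hS g] with t ht
    rw [ht, hL]
  rw [hhS, key]
  exact hM _

end Multiplication

/-! ### Boundedness, measurability and the weak form of the matrix symbol. -/

section Symbol

variable {Ω : Type*} {n : ℕ} {K : Ω → ℂ}
  {A : Ω → Matrix (Fin n) (Fin n) ℝ} {C : Matrix (Fin n) (Fin n) ℝ}
  {e : Fin (2 ^ n) ≃ (Fin n → ℤˣ)}

/-- The kernel `K` cut off to `Ω_ij`. -/
def signKernel (K : Ω → ℂ) (A : Ω → Matrix (Fin n) (Fin n) ℝ) (C : Matrix (Fin n) (Fin n) ℝ)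
    (e : Fin (2 ^ n) ≃ (Fin n → ℤˣ)) (i j : Fin (2 ^ n)) : Ω → ℂ :=
  (signSet (diagEntry C A) e i j).indicator K

theorem norm_signKernel_mul_absPow_le (hC : Diagonalizes C A) {u : Ω} (hu : (A u).det ≠ 0)
    (i j : Fin (2 ^ n)) (s : Rn n) :
    ‖signKernel K A C e i j u * absPow (diagEntry C A u) s‖ ≤
      ‖((|(A u).det| ^ (-(1 / 2) : ℝ) : ℝ) : ℂ) * K u‖ := by
  rw [norm_mul, norm_absPow _ (hC.diagEntry_ne_zero hu), ← hC.abs_det_eq, norm_mul,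
    Complex.norm_of_nonneg (by positivity), mul_comm]
  gcongr
  exact norm_indicator_le_norm_self _ _

variable [MeasurableSpace Ω] {μ : Measure Ω}

theorem aemeasurable_diagEntry (hA : ∀ k l, AEMeasurable (fun u => A u k l) μ) (k : Fin n) :
    AEMeasurable (fun u => diagEntry C A u k) μ := by
  simp only [diagEntry, Matrix.mul_apply]
  fun_prop

theorem measurable_real_sign : Measurable Real.sign :=
  Measurable.ite measurableSet_Iio measurable_const
    (Measurable.ite measurableSet_Ioi measurable_const measurable_const)

theorem nullMeasurableSet_signSet (hA : ∀ k l, AEMeasurable (fun u => A u k l) μ)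
    (i j : Fin (2 ^ n)) : NullMeasurableSet (signSet (diagEntry C A) e i j) μ := by
  simp only [signSet, Set.ofPred_forall]
  refine NullMeasurableSet.iInter fun k => ?_
  exact (measurable_real_sign.comp_aemeasurable (aemeasurable_diagEntry hA k)).nullMeasurable
    (measurableSet_singleton _)

/-- Moving the restriction to `Ω_ij` into the kernel puts all entries on the same measure `μ`, so
that sums over `i`, `j` can go under one integral. -/
theorem symbol_eq_integral (hA : ∀ k l, AEMeasurable (fun u => A u k l) μ) (s : Rn n)
    (i j : Fin (2 ^ n)) :
    symbol μ K A C e s i j = ∫ u, signKernel K A C e i j u * absPow (diagEntry C A u) s ∂μ := by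
  rw [symbol, Matrix.of_apply, ← integral_indicator₀ (nullMeasurableSet_signSet hA i j)]
  refine integral_congr_ae (Filter.Eventually.of_forall fun u => ?_)
  simp only [signKernel, Set.indicator_mul_left]

theorem aestronglyMeasurable_signKernel_mul_absPow
    (hA : ∀ k l, AEMeasurable (fun u => A u k l) μ) (hdet : ∀ᵐ u ∂μ, (A u).det ≠ 0)
    (hK : Integrable (fun u => ((|(A u).det| ^ (-(1 / 2) : ℝ) : ℝ) : ℂ) * K u) μ)
    (i j : Fin (2 ^ n)) :
    AEStronglyMeasurable
      (fun p : Rn n × Ω => signKernel K A C e i j p.2 * absPow (diagEntry C A p.2) p.1)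
      ((volume : Measure (Rn n)).prod μ) := by
  have h1 : AEStronglyMeasurable (signKernel K A C e i j) μ :=
    (aestronglyMeasurable_of_det_smul hA hdet hK).indicator₀ (nullMeasurableSet_signSet hA i j)
  have h2 : ∀ k, AEMeasurable (fun p : Rn n × Ω => diagEntry C A p.2 k)
      ((volume : Measure (Rn n)).prod μ) := fun k =>
    (aemeasurable_diagEntry hA k).comp_quasiMeasurePreserving Measure.quasiMeasurePreserving_snd
  refine (h1.comp_quasiMeasurePreserving Measure.quasiMeasurePreserving_snd).mul ?_
  refine AEMeasurable.aestronglyMeasurable ?_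
  simp only [absPow]
  refine Finset.aemeasurable_fun_prod _ fun k _ => ?_
  have h3 : Measurable fun p : Rn n × Ω => p.1 k := by
    have : Measurable fun x : Rn n => x k := by fun_prop
    exact this.comp measurable_fst
  have h4 : AEMeasurable (fun p : Rn n × Ω => Real.log |diagEntry C A p.2 k|)
      ((volume : Measure (Rn n)).prod μ) :=
    Real.measurable_log.comp_aemeasurable (measurable_norm.comp_aemeasurable (h2 k))
  fun_prop

theorem norm_symbol_le (hC : Diagonalizes C A)
    (hA : ∀ k l, AEMeasurable (fun u => A u k l) μ) (hdet : ∀ᵐ u ∂μ, (A u).det ≠ 0)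
    (hK : Integrable (fun u => ((|(A u).det| ^ (-(1 / 2) : ℝ) : ℝ) : ℂ) * K u) μ)
    (s : Rn n) (i j : Fin (2 ^ n)) : ‖symbol μ K A C e s i j‖ ≤
      ∫ u, ‖((|(A u).det| ^ (-(1 / 2) : ℝ) : ℝ) : ℂ) * K u‖ ∂μ := by
  rw [symbol_eq_integral hA]
  exact norm_integral_le_of_norm_le hK.norm
    (hdet.mono fun u hu => norm_signKernel_mul_absPow_le hC hu i j s)

variable [SFinite μ]

theorem aestronglyMeasurable_symbol
    (hA : ∀ k l, AEMeasurable (fun u => A u k l) μ) (hdet : ∀ᵐ u ∂μ, (A u).det ≠ 0)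
    (hK : Integrable (fun u => ((|(A u).det| ^ (-(1 / 2) : ℝ) : ℝ) : ℂ) * K u) μ)
    (i j : Fin (2 ^ n)) :
    AEStronglyMeasurable fun s : Rn n => symbol μ K A C e s i j := by
  simp only [symbol_eq_integral hA]
  exact (aestronglyMeasurable_signKernel_mul_absPow hA hdet hK i j).integral_prod_right'

theorem exists_isMultiplicationOperator_symbol (hC : Diagonalizes C A)
    (hA : ∀ k l, AEMeasurable (fun u => A u k l) μ) (hdet : ∀ᵐ u ∂μ, (A u).det ≠ 0)
    (hK : Integrable (fun u => ((|(A u).det| ^ (-(1 / 2) : ℝ) : ℝ) : ℂ) * K u) μ)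
    (e : Fin (2 ^ n) ≃ (Fin n → ℤˣ)) :
    ∃ M : L2vec n →L[ℂ] L2vec n, IsMultiplicationOperator (symbol μ K A C e) M :=
  exists_isMultiplicationOperator (aestronglyMeasurable_symbol hA hdet hK)
    (norm_symbol_le hC hA hdet hK)

/-- The weak form of multiplication by the matrix symbol. -/
theorem IsMultiplicationOperator.inner_eq (hC : Diagonalizes C A)
    (hA : ∀ k l, AEMeasurable (fun u => A u k l) μ) (hdet : ∀ᵐ u ∂μ, (A u).det ≠ 0)
    (hK : Integrable (fun u => ((|(A u).det| ^ (-(1 / 2) : ℝ) : ℝ) : ℂ) * K u) μ)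
    {M : L2vec n →L[ℂ] L2vec n} (hM : IsMultiplicationOperator (symbol μ K A C e) M)
    (f g : L2vec n) :
    inner ℂ g (M f) = ∫ u, (∫ s : Rn n, ∑ i, ∑ j,
      signKernel K A C e i j u * absPow (diagEntry C A u) s *
        (f s j * starRingEnd ℂ (g s i))) ∂μ := by
  have hint : ∀ i j, Integrable (fun p : Rn n × Ω =>
      signKernel K A C e i j p.2 * absPow (diagEntry C A p.2) p.1 *
        (f p.1 j * starRingEnd ℂ (g p.1 i))) ((volume : Measure (Rn n)).prod μ) := by
    intro i j
    have hcoord : ∀ (h : L2vec n) (l : Fin (2 ^ n)), MemLp (fun s => h s l) 2 volume := by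
      intro h l
      refine (Lp.memLp h).of_le ?_ (Filter.Eventually.of_forall fun s => PiLp.norm_apply_le _ l)
      have : Continuous fun v : Cpow n => v l := by fun_prop
      exact this.comp_aestronglyMeasurable (Lp.memLp h).1
    have hfg : Integrable (fun s => f s j * starRingEnd ℂ (g s i)) volume :=
      (hcoord f j).integrable_mul (hcoord g i).star
    -- The dominating function is a tensor product: `f j * conj (g i)` in `s`, and the weighted
    -- kernel in `u`, since `absPow` has modulus independent of `s`.
    refine (hfg.mul_prod hK).mono
      ((aestronglyMeasurable_signKernel_mul_absPow hA hdet hK i j).mul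
        hfg.1.comp_fst) ?_
    filter_upwards [Measure.quasiMeasurePreserving_snd.ae hdet] with p hp
    rw [norm_mul, norm_mul _ (_ * K p.2), mul_comm]
    gcongr
    exact norm_signKernel_mul_absPow_le hC hp i j p.1
  have hsum : Integrable (Function.uncurry fun (s : Rn n) u => ∑ i, ∑ j,
      signKernel K A C e i j u * absPow (diagEntry C A u) s *
        (f s j * starRingEnd ℂ (g s i))) ((volume : Measure (Rn n)).prod μ) :=
    integrable_finsetSum _ fun i _ => integrable_finsetSum _ fun j _ => hint i j
  rw [← integral_integral_swap hsum, L2.inner_def]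
  refine integral_congr_ae ?_
  have hae : ∀ᵐ s : Rn n, ∀ i j, Integrable (fun u =>
      signKernel K A C e i j u * absPow (diagEntry C A u) s *
        (f s j * starRingEnd ℂ (g s i))) μ :=
    ae_all_iff.2 fun i => ae_all_iff.2 fun j => (hint i j).prod_right_ae
  filter_upwards [hM f, hae] with s h1 h2
  rw [h1, integral_finsetSum _ fun i _ => integrable_finsetSum _ fun j _ => h2 i j,
    PiLp.inner_apply]
  refine Finset.sum_congr rfl fun i _ => ?_
  rw [integral_finsetSum _ fun j _ => h2 i j]
  simp only [RCLike.inner_apply, Matrix.mulVec, dotProduct, Finset.sum_mul]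
  refine Finset.sum_congr rfl fun j _ => ?_
  rw [integral_mul_const, symbol_eq_integral hA, mul_assoc]

end Symbol

/-! ### The Hausdorff operator becomes multiplication by its symbol. -/

section Equivalence

variable {n : ℕ} {C : Matrix (Fin n) (Fin n) ℝ} {e : Fin (2 ^ n) ≃ (Fin n → ℤˣ)}

/-- The character is `exp (2πi ⟨·, ·⟩)`; its `2π` cancels the one in `logShift` and leaves `exp (-i
s k log |a k|)`. This is why `expCoord` carries the factor `2π`. -/
theorem absPow_eq {a : Fin n → ℝ} (ha : ∀ k, a k ≠ 0) (s : Rn n) :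
    absPow a s = ((Real.fourierChar (inner ℝ (logShift a) s) : Circle) : ℂ) *
      (((∏ k, |a k|) ^ (-(1 / 2) : ℝ) : ℝ) : ℂ) := by
  rw [Real.fourierChar_apply, ← Real.finsetProd_rpow _ _ (fun k _ => abs_nonneg _),
    PiLp.inner_apply, absPow]
  push_cast
  rw [Finset.mul_sum, Finset.sum_mul, Complex.exp_sum, ← Finset.prod_mul_distrib]
  refine Finset.prod_congr rfl fun k _ => ?_
  rw [Real.rpow_def_of_pos (abs_pos.2 (ha k)), Complex.ofReal_exp, ← Complex.exp_add]
  congr 1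
  have hpi : (Real.pi : ℂ) ≠ 0 := Complex.ofReal_ne_zero.2 Real.pi_ne_zero
  simp only [logShift, RCLike.inner_apply, conj_trivial]
  push_cast
  field_simp
  ring

variable {Ω : Type*} {A : Ω → Matrix (Fin n) (Fin n) ℝ}

/-- Mellin transform on all the hyperoctants takes the dilation by `A u` to a matrix multiplier. -/
theorem fourier_octEquiv_comp_act (hC : Diagonalizes C A) {u : Ω} (hu : (A u).det ≠ 0)
    {τ : Fin n → ℤˣ} (hτ : ∀ k, Real.sign (diagEntry C A u k) = ((τ k : ℤ) : ℝ))
    {T : L2 n ≃ₗᵢ[ℂ] L2vec n} (hT : ∀ f : L2 n, T f =ᵐ[volume] octMap C e f)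
    {f h : L2 n} (hh : h =ᵐ[volume] fun x => f (act (A u) x)) :
    ∀ᵐ s : Rn n, ∀ i, Lp.fourierTransformₗᵢ (Rn n) (Cpow n) (T h) s i =
      absPow (diagEntry C A u) s *
        Lp.fourierTransformₗᵢ (Rn n) (Cpow n) (T f) s (e.symm (e i * τ)) := by
  -- The permutation of hyperoctants induced by the signs of `A u`, scaled by `|det A u|^(-1/2)`.
  let P : Matrix (Fin (2 ^ n)) (Fin (2 ^ n)) ℂ := Matrix.of fun i j =>
    if j = e.symm (e i * τ) then ((|(A u).det| ^ (-(1 / 2) : ℝ) : ℝ) : ℂ) else 0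
  have hP : ∀ (v : Fin (2 ^ n) → ℂ) i, (P *ᵥ v) i =
      ((|(A u).det| ^ (-(1 / 2) : ℝ) : ℝ) : ℂ) * v (e.symm (e i * τ)) := by
    intro v i
    simp [P, Matrix.mulVec, dotProduct]
  have h1 : T h =ᵐ[volume] fun t => WithLp.toLp 2
      (P *ᵥ WithLp.ofLp (T f (t + logShift (diagEntry C A u)))) := by
    have hshift := (measurePreserving_add_right volume
      (logShift (diagEntry C A u))).quasiMeasurePreserving.ae (hT f)
    filter_upwards [hT h, octMap_congr_ae (e := e) hC.1 hh, hshift] with t h2 h3 h4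
    rw [h2, h3, h4]
    ext i
    rw [octMap_comp_act hC hu hτ]
    simp only [hP]
  filter_upwards [fourier_translate_matrix P _ h1] with s hs i
  rw [hs]
  simp only [Matrix.smul_mulVec, Pi.smul_apply, hP, smul_eq_mul]
  rw [absPow_eq (hC.diagEntry_ne_zero hu), ← hC.abs_det_eq, mul_assoc]

variable [MeasurableSpace Ω] {μ : Measure Ω} [SFinite μ] {K : Ω → ℂ}

/-- Tested against an arbitrary `g`, both sides are integrals over `u`, and the integrands agree for
almost every `u` by the result for a single dilation. -/
theorem fourier_octEquiv_hausdorff (hC : Diagonalizes C A)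
    (hA : ∀ k l, AEMeasurable (fun u => A u k l) μ) (hdet : ∀ᵐ u ∂μ, (A u).det ≠ 0)
    (hK : Integrable (fun u => ((|(A u).det| ^ (-(1 / 2) : ℝ) : ℝ) : ℂ) * K u) μ)
    {T : L2 n ≃ₗᵢ[ℂ] L2vec n} (hT : ∀ f : L2 n, T f =ᵐ[volume] octMap C e f)
    {H : L2 n →L[ℂ] L2 n} (hH : IsHausdorffOperator μ K A H)
    {M : L2vec n →L[ℂ] L2vec n} (hM : IsMultiplicationOperator (symbol μ K A C e) M) (f : L2 n) :
    (T.trans (Lp.fourierTransformₗᵢ (Rn n) (Cpow n))) (H f) =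
      M ((T.trans (Lp.fourierTransformₗᵢ (Rn n) (Cpow n))) f) := by
  set V := T.trans (Lp.fourierTransformₗᵢ (Rn n) (Cpow n)) with hV
  refine ext_inner_left ℂ fun g => ?_
  rw [hM.inner_eq hC hA hdet hK]
  have h1 : inner ℂ g (V (H f)) = inner ℂ (V.symm g) (H f) := by
    rw [← V.inner_map_map, V.apply_symm_apply]
  rw [h1, hH.inner_eq hA hdet hK]
  refine integral_congr_ae ?_
  filter_upwards [hdet] with u hu
  obtain ⟨τ, hτ⟩ := exists_signVector _ (hC.diagEntry_ne_zero hu)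
  have hmem := memLp_comp_act hu (Lp.memLp f)
  have h2 : ∫ x : Rn n, inner ℂ (V.symm g x) (f (act (A u) x)) =
      inner ℂ g (V hmem.toLp) := by
    rw [← V.symm.inner_map_map, V.symm_apply_apply, L2.inner_def]
    refine integral_congr_ae ?_
    filter_upwards [hmem.coeFn_toLp] with x hx
    rw [hx]
  rw [h2, L2.inner_def, ← integral_const_mul]
  refine integral_congr_ae ?_
  filter_upwards [fourier_octEquiv_comp_act hC hu hτ hT hmem.coeFn_toLp] with s hs
  rw [PiLp.inner_apply, Finset.mul_sum]
  refine Finset.sum_congr rfl fun i _ => ?_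
  have h3 : V hmem.toLp s i = absPow (diagEntry C A u) s * V f s (e.symm (e i * τ)) := hs i
  -- In row `i` the cut-off kernels vanish at `u` except for the one `j` reached from `i` by the
  -- signs `τ`.
  rw [h3, Finset.sum_eq_single (e.symm (e i * τ))]
  · rw [signKernel, Set.indicator_of_mem ((mem_signSet_iff hτ).2 rfl), RCLike.inner_apply]
    ring
  · intro j _ hj
    rw [signKernel, Set.indicator_of_notMem fun h => hj ((mem_signSet_iff hτ).1 h)]
    simp
  · simp

end Equivalence

end

end Hausdorff

/-! ### The product of two Hausdorff operators. -/

theorem corollary2 {Ω : Type*} [TopologicalSpace Ω] [SigmaCompactSpace Ω] [MeasurableSpace Ω]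
    [BorelSpace Ω] (μ : Measure Ω) [μ.Regular] (n : ℕ)
    (K₁ K₂ : Ω → ℂ) (A B : Ω → Matrix (Fin n) (Fin n) ℝ)
    (hK₁ : LocallyIntegrable K₁ μ) (hK₂ : LocallyIntegrable K₂ μ)
    (hA : ∀ k l, AEMeasurable (fun u => A u k l) μ) (hB : ∀ k l, AEMeasurable (fun v => B v k l) μ)
    (hAsymm : ∀ u, (A u).IsHermitian) (hBsymm : ∀ v, (B v).IsHermitian)
    (hAA : ∀ u u', Commute (A u) (A u')) (hBB : ∀ v v', Commute (B v) (B v'))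
    (hAB : ∀ u v, Commute (A u) (B v))
    (hAdet : ∀ᵐ u ∂μ, (A u).det ≠ 0) (hBdet : ∀ᵐ v ∂μ, (B v).det ≠ 0)
    (hAK : Integrable (fun u => ((|(A u).det| ^ (-(1 / 2) : ℝ) : ℝ) : ℂ) * K₁ u) μ)
    (hBK : Integrable (fun v => ((|(B v).det| ^ (-(1 / 2) : ℝ) : ℝ) : ℂ) * K₂ v) μ) :
    (∃! H₁ : Hausdorff.L2 n →L[ℂ] Hausdorff.L2 n, Hausdorff.IsHausdorffOperator μ K₁ A H₁) ∧
    (∃! H₂ : Hausdorff.L2 n →L[ℂ] Hausdorff.L2 n, Hausdorff.IsHausdorffOperator μ K₂ B H₂) ∧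
    (∃ C : Matrix (Fin n) (Fin n) ℝ, Hausdorff.Diagonalizes C A ∧ Hausdorff.Diagonalizes C B) ∧
    ∀ C : Matrix (Fin n) (Fin n) ℝ, Hausdorff.Diagonalizes C A → Hausdorff.Diagonalizes C B →
    ∀ e : Fin (2 ^ n) ≃ (Fin n → ℤˣ),
      (∃! M : Hausdorff.L2vec n →L[ℂ] Hausdorff.L2vec n, Hausdorff.IsMultiplicationOperator
        (fun s => Hausdorff.symbol μ K₁ A C e s * Hausdorff.symbol μ K₂ B C e s) M) ∧
      ∀ (H₁ H₂ : Hausdorff.L2 n →L[ℂ] Hausdorff.L2 n)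
        (M : Hausdorff.L2vec n →L[ℂ] Hausdorff.L2vec n),
        Hausdorff.IsHausdorffOperator μ K₁ A H₁ → Hausdorff.IsHausdorffOperator μ K₂ B H₂ →
        Hausdorff.IsMultiplicationOperator
          (fun s => Hausdorff.symbol μ K₁ A C e s * Hausdorff.symbol μ K₂ B C e s) M →
        Hausdorff.UnitarilyEquivalent (H₁ ∘L H₂) M := by
  -- A regular measure is finite on compact sets, so σ-compactness makes `μ` σ-finite; this supplies
  -- the `SFinite μ` behind every use of Fubini.
  have hex₁ := Hausdorff.existsUnique_isHausdorffOperator hA hAdet hAK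
  have hex₂ := Hausdorff.existsUnique_isHausdorffOperator hB hBdet hBK
  refine ⟨hex₁, hex₂, ?_, fun C hCA hCB e => ?_⟩
  -- Both families are joined into one commuting family over the disjoint union, which gives a
  -- common `C`.
  · obtain ⟨C, hC⟩ := Hausdorff.exists_orthogonal_diagonalizing (Sum.elim A B)
      (Sum.forall.2 ⟨hAsymm, hBsymm⟩) (Sum.forall.2
        ⟨fun u => Sum.forall.2 ⟨hAA u, hAB u⟩,
          fun v => Sum.forall.2 ⟨fun u => (hAB u v).symm, hBB v⟩⟩)
    exact ⟨C, ⟨hC.1, fun u => hC.2 (Sum.inl u)⟩, ⟨hC.1, fun v => hC.2 (Sum.inr v)⟩⟩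
  · obtain ⟨M₁, hM₁⟩ :=
      Hausdorff.exists_isMultiplicationOperator_symbol hCA hA hAdet hAK e
    obtain ⟨M₂, hM₂⟩ :=
      Hausdorff.exists_isMultiplicationOperator_symbol hCB hB hBdet hBK e
    refine ⟨⟨M₁ ∘L M₂, hM₁.comp hM₂, fun M hM => hM.unique (hM₁.comp hM₂)⟩,
      fun H₁ H₂ M hH₁ hH₂ hM => ?_⟩
    -- `T` uses only the orthogonality of `C` and the enumeration `e`, so it serves `A` and `B`
    -- alike.
    obtain ⟨T, hT⟩ := Hausdorff.exists_octEquiv hCA.1 e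
    refine ⟨T.trans (Lp.fourierTransformₗᵢ (Hausdorff.Rn n) (Hausdorff.Cpow n)), fun f => ?_⟩
    rw [hM.unique (hM₁.comp hM₂), ContinuousLinearMap.comp_apply, ContinuousLinearMap.comp_apply,
      Hausdorff.fourier_octEquiv_hausdorff hCA hA hAdet hAK hT hH₁ hM₁,
      Hausdorff.fourier_octEquiv_hausdorff hCB hB hBdet hBK hT hH₂ hM₂]
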